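/- **Setting.** Let $(\Omega,\mathcal F,\mathbb P)$ be a probability space, $Z$ a random variable with values in a Polish space $\mathsf Z$, $(Z_i)_{i\ge1}$ i.i.d. copies of $Z$, and $f:\mathbb R^d\times\mathsf Z\to\mathbb R$ a measurable function such that $F(\theta):=\mathbb E[f(\theta,Z)]$ is well defined and finite for all $\theta\in\mathbb R^d$ and such that $F$ has a global minimiser $\theta_\star$ (it is unique under A1). Let $F_n(\theta)=\frac1n\sum_{i=1}^n f(\theta,Z_i)$, and write $\nabla f,\nabla^2 f$ for the derivatives of $f$ in $\theta$. One evaluation of $f(\theta,z)$ costs $C_{\mathrm{eval}}\in\{1,2,\dots\}$ and one evaluation of $\nabla f(\theta,z)$ costs $C_{\mathrm{grad}}\in\{1,2,\dots\}$. **A1.** For every compact $\Theta\subset\mathbb R^d$ there is $c_\Theta>0$ such that $F(a\theta_1+(1-a)\theta_2)\le aF(\theta_1)+(1-a)F(\theta_2)-\frac{c_\Theta}{2}a(1-a)\|\theta_1-\theta_2\|^2$ for all $a\in[0,1]$ and $\theta_1,\theta_2\in\Theta$. **A2 (with parameter $\alpha\in(0,1]$).** For all $z\in\mathsf Z$ the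 function $\theta\mapsto f(\theta,z)$ is twice continuously differentiable on $\mathbb R^d$; $\mathbb E\|\nabla^2f(\theta_\star,Z)\|<\infty$ and $\mathbb E\big[\|\nabla f(\theta_\star,Z)\|^{1+\alpha}\big]<\infty$; and for every compact $\Theta\subset\mathbb R^d$ there is a measurable $M_\Theta:\mathsf Z\to[0,\infty)$ with $\mathbb E[M_\Theta(Z)]<\infty$ such that, almost surely, $\|\nabla^2f(\theta,Z)-\nabla^2f(\theta',Z)\|\le M_\Theta(Z)\|\theta-\theta'\|$ for all $\theta,\theta'\in\Theta$. **GD-BLS$(x_0,n,b,\epsilon,\beta)$** (start $x_0\in\mathbb R^d$, sample size $n\ge1$, integer budget $b\ge0$, tolerance $\epsilon\ge0$, $\beta\in(0,1)$). Every evaluation of $\nabla F_n$ (cost $nC_{\mathrm{grad}}$) or $F_n$ (cost $nC_{\mathrm{eval}}$) is made only if the remaining budget covers its cost, which is then deducted. 1. Set $x=x_0$; if affordable compute $G=\nabla F_n(x)$; then, if affordable, compute $F_n(x)$. If $G$ was not affordable, stop without moving. 2. While $\|G\|>\epsilon$ and the remaining budget is at least $nC_{\mathrm{eval}}$: set $v=1$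 and evaluate $F_n(x-vG)$. While $F_n(x-vG)>F_n(x)-\frac v2\|G\|^2$ and one more evaluation of $F_n$ is affordable, replace $v$ by $\beta v$ and evaluate $F_n(x-vG)$. If finally $F_n(x-vG)\le F_n(x)-\frac v2\|G\|^2$, replace $x$ by $x-vG$ and then, if affordable, set $G=\nabla F_n(x)$, otherwise stop. 3. Return $x$ and the remaining budget. **Multi-stage estimator.** Given $\theta_0\in\mathbb R^d$, a budget $B\in\{1,2,\dots\}$, $\alpha'\in(0,1]$, $\delta\in(0,1)$, $J\in\{1,2,\dots\}$, $\kappa,\tau>0$ and $\beta\in(0,1)$, set $\hat\theta_{0,B}=\theta_0$, $B_0=B$ and, for $j=1,2,\dots$, as long as $j\le J$ and $B_{j-1}>0$, with $\gamma_j=1-\delta^j$, $$(\hat\theta_{j,B},B_j)=\text{GD-BLS}\Big(\hat\theta_{j-1,B},\ \lceil\kappa B^{\gamma_j}\rceil,\ B_{j-1},\ \tau B^{-\frac{\alpha'}{1+\alpha'}\gamma_j},\ \beta\Big).$$ The estimator $\hat\theta_{J,B}$ is the last point computed. **Theorem.** Assume A1, and A2 for some $\alpha\in(0,1]$. Let $\alpha'\in(0,1]$,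 $\theta_0\in\mathbb R^d$, $J\in\{1,2,\dots\}$, $\kappa,\tau\in(0,\infty)$, $\beta\in(0,1)$ and $\delta\in\big(\frac{2\alpha'}{1+3\alpha'},1\big)$. Then $\|\hat\theta_{J,B}-\theta_\star\|\to0$ in probability as $B\to\infty$. If moreover A2 holds with $\alpha=\alpha'$, then $$\|\hat\theta_{J,B}-\theta_\star\|=\mathcal O_{\mathbb P}\Big(B^{-\frac{\alpha'}{1+\alpha'}(1-\delta^J)}\Big),$$ that is, for every $\varepsilon\in(0,1)$ there is a finite $M_\varepsilon$ with $\limsup_{B\to\infty}\mathbb P\big(\|\hat\theta_{J,B}-\theta_\star\|\ge M_\varepsilon B^{-\frac{\alpha'}{1+\alpha'}(1-\delta^J)}\big)\le\varepsilon$. -/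

import Mathlib

open MeasureTheory ProbabilityTheory Filter Topology

noncomputable section

namespace NoisyOpt

/-- The search space `ℝ^d` with its Euclidean norm. -/
abbrev Vec (d : ℕ) := EuclideanSpace ℝ (Fin d)

/-- The objective function `F(θ) = 𝔼[f(θ, Z)]`. -/
def risk {d : ℕ} {Ω 𝓩 : Type*} [MeasurableSpace Ω] (P : Measure Ω)
    (f : Vec d → 𝓩 → ℝ) (Z : Ω → 𝓩) (θ : Vec d) : ℝ :=
  ∫ ω, f θ (Z ω) ∂P

/-- The empirical objective `F_n(θ) = n⁻¹ ∑_{i=1}^n f(θ, z_i)` for a data sequence `z`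
(indexed here from `0`). -/
def empRisk {d : ℕ} {𝓩 : Type*} (f : Vec d → 𝓩 → ℝ) (z : ℕ → 𝓩) (n : ℕ) (θ : Vec d) : ℝ :=
  (n : ℝ)⁻¹ * ∑ i ∈ Finset.range n, f θ (z i)

/-- The gradient `∇_θ f(θ, z)`. -/
def gradF {d : ℕ} {𝓩 : Type*} (f : Vec d → 𝓩 → ℝ) (θ : Vec d) (z : 𝓩) : Vec d :=
  gradient (fun θ' => f θ' z) θ

/-- The Hessian `∇²_θ f(θ, z)`, as a linear operator with its operator norm. -/
def hessF {d : ℕ} {𝓩 : Type*} (f : Vec d → 𝓩 → ℝ) (θ : Vec d) (z : 𝓩) : Vec d →L[ℝ] Vec d :=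
  fderiv ℝ (fun θ' => gradF f θ' z) θ

/-- Local strong convexity: strong convexity on each compact set, with a constant depending on the set. -/
def LocallyStronglyConvex {d : ℕ} (F : Vec d → ℝ) : Prop :=
  ∀ Θ : Set (Vec d), IsCompact Θ → ∃ c : ℝ, 0 < c ∧
    ∀ a ∈ Set.Icc (0 : ℝ) 1, ∀ θ₁ ∈ Θ, ∀ θ₂ ∈ Θ,
      F (a • θ₁ + (1 - a) • θ₂) ≤
        a * F θ₁ + (1 - a) * F θ₂ - c / 2 * (a * (1 - a)) * ‖θ₁ - θ₂‖ ^ 2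

/-- Smoothness and moment condition with moment parameter `α`. -/
structure SmoothMoment {d : ℕ} {Ω 𝓩 : Type*} [MeasurableSpace Ω] [MeasurableSpace 𝓩]
    (P : Measure Ω) (f : Vec d → 𝓩 → ℝ) (Z : Ω → 𝓩) (θstar : Vec d) (α : ℝ) : Prop where
  contDiff : ∀ z, ContDiff ℝ 2 (fun θ => f θ z)
  integrable_hess : Integrable (fun ω => ‖hessF f θstar (Z ω)‖) P
  integrable_grad : Integrable (fun ω => ‖gradF f θstar (Z ω)‖ ^ (1 + α)) P
  lipschitz_hess : ∀ Θ : Set (Vec d), IsCompact Θ → ∃ M : 𝓩 → ℝ,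
    Measurable M ∧ (∀ z, 0 ≤ M z) ∧ Integrable (fun ω => M (Z ω)) P ∧
      ∀ᵐ ω ∂P, ∀ θ ∈ Θ, ∀ θ' ∈ Θ,
        ‖hessF f θ (Z ω) - hessF f θ' (Z ω)‖ ≤ M (Z ω) * ‖θ - θ'‖

/-- The inner loop (backtracking) of GD-BLS for the function `g` at the point `x` with gradient
`G`. Here `v` is the current step size, for which `g (x - v • G)` has already been evaluated, `b`
is the remaining budget and `ce` is the cost of one evaluation of `g`. The loop goes on as long as
the decrease condition fails and one more evaluation is affordable; it returns the final step size
and the remaining budget. (The test `0 < ce` only serves termination.) -/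
def backtrack {d : ℕ} (ce : ℕ) (g : Vec d → ℝ) (β : ℝ) (x G : Vec d) (v : ℝ) (b : ℕ) : ℝ × ℕ :=
  open Classical in
  if _h : 0 < ce ∧ ce ≤ b ∧ g x - v / 2 * ‖G‖ ^ 2 < g (x - v • G) then
    backtrack ce g β x G (β * v) (b - ce)
  else (v, b)
termination_by b
decreasing_by omega

theorem backtrack_snd_le {d : ℕ} (ce : ℕ) (g : Vec d → ℝ) (β : ℝ) (x G : Vec d) (v : ℝ) (b : ℕ) :
    (backtrack ce g β x G v b).2 ≤ b := by
  induction b using Nat.strong_induction_on generalizing v with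
  | _ b ih =>
    rw [backtrack]
    split_ifs with h
    · exact (ih (b - ce) (by omega) _).trans (Nat.sub_le _ _)
    · exact le_rfl

/-- The outer loop of GD-BLS: `x` is the current iterate, `G` the gradient of `g` at `x`, `b` the
remaining budget, `ce` and `cg` the costs of one evaluation of `g` and of its gradient, and `τ` the
tolerance. It returns the final iterate and the remaining budget. (The test `0 < ce` only serves
termination.) -/
def gdLoop {d : ℕ} (ce cg : ℕ) (g : Vec d → ℝ) (τ β : ℝ) (x G : Vec d) (b : ℕ) : Vec d × ℕ :=
  open Classical in
  if _h : 0 < ce ∧ τ < ‖G‖ ∧ ce ≤ b then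
    -- the step size 1 is tried first, at the cost of one evaluation
    let r := backtrack ce g β x G 1 (b - ce)
    if g (x - r.1 • G) ≤ g x - r.1 / 2 * ‖G‖ ^ 2 then
      if cg ≤ r.2 then
        gdLoop ce cg g τ β (x - r.1 • G) (gradient g (x - r.1 • G)) (r.2 - cg)
      else (x - r.1 • G, r.2)
    else gdLoop ce cg g τ β x G r.2
  else (x, b)
termination_by b
decreasing_by
  all_goals
    have := backtrack_snd_le ce g β x G 1 (b - ce)
    omega

/-- GD-BLS started at `x₀` with budget `B` and tolerance `τ`: gradient descent with backtracking
line search for `g`, where `ce` and `cg` are the costs of one evaluation of `g` and of its gradient.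
If the budget does not even allow to compute the first gradient, then no step is made. -/
def gdBls {d : ℕ} (ce cg : ℕ) (g : Vec d → ℝ) (x₀ : Vec d) (B : ℕ) (τ β : ℝ) : Vec d × ℕ :=
  let b₁ := if cg ≤ B then B - cg else B
  let b₂ := if ce ≤ b₁ then b₁ - ce else b₁
  if cg ≤ B then gdLoop ce cg g τ β x₀ (gradient g x₀) b₂ else (x₀, b₂)

/-- The multi-stage algorithm on the data sequence `z`: the pair `(θ̂_{j,B}, B_j)` after at most `j`
calls of GD-BLS. The `j`-th call uses the first `⌈κ B^{γ_j}⌉` data points and the tolerance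
`τ B^{-α' γ_j / (1 + α')}`, where `γ_j = 1 - δ^j`. Once the budget is exhausted nothing changes. -/
def multiStage {d : ℕ} {𝓩 : Type*} (Ceval Cgrad : ℕ) (f : Vec d → 𝓩 → ℝ) (z : ℕ → 𝓩)
    (θ₀ : Vec d) (B : ℕ) (α' δ κ τ β : ℝ) : ℕ → Vec d × ℕ
  | 0 => (θ₀, B)
  | j + 1 =>
    let s := multiStage Ceval Cgrad f z θ₀ B α' δ κ τ β j
    if 0 < s.2 then
      let γ : ℝ := 1 - δ ^ (j + 1)
      let n : ℕ := ⌈κ * (B : ℝ) ^ γ⌉₊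
      gdBls (n * Ceval) (n * Cgrad) (empRisk f z n) s.1 s.2
        (τ * (B : ℝ) ^ (-(α' / (1 + α') * γ))) β
    else s

/-- The estimator `θ̂_{J,B}` returned by the multi-stage algorithm with at most `J` calls. -/
def estimator {d : ℕ} {𝓩 : Type*} (Ceval Cgrad : ℕ) (f : Vec d → 𝓩 → ℝ) (z : ℕ → 𝓩)
    (θ₀ : Vec d) (B : ℕ) (α' δ : ℝ) (J : ℕ) (κ τ β : ℝ) : Vec d :=
  (multiStage Ceval Cgrad f z θ₀ B α' δ κ τ β J).1

/-- `X_t = O_ℙ(a_t)`: for all `ε ∈ (0,1)` there is a finite constant `M` such that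
`limsup_t ℙ(|X_t / a_t| ≥ M) ≤ ε`. -/
def IsBigOP {Ω : Type*} [MeasurableSpace Ω] (P : Measure Ω) (X : ℕ → Ω → ℝ) (a : ℕ → ℝ) : Prop :=
  ∀ ε ∈ Set.Ioo (0 : ℝ) 1, ∃ M : ℝ,
    limsup (fun t => P {ω | M ≤ |X t ω / a t|}) atTop ≤ ENNReal.ofReal ε

end NoisyOpt

end

namespace NoisyOpt

open scoped RealInnerProductSpace

/-! ### Second-order Taylor bounds -/

/-! With probability tending to one, each of the `J` empirical risks is so close to `F` on a fixed
ball that gradient descent behaves as on a smooth strongly convex function, and the budget lets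
every stage reach its tolerance. The error is then at most a constant times the last tolerance plus
the norm of the last empirical gradient at the minimiser.

Localisation: strong convexity confines a sublevel set of `F` to a ball of radius `R`
(`LocallyStronglyConvex.exists_sublevel_subset`). On balls the derivatives have an integrable
envelope, so laws of large numbers for the envelopes and for finitely many values of `f` give
`GoodApprox` (`tendsto_measure_not_goodApprox`). Uniform closeness alone does not make the empirical
risk convex, but with a Lipschitz Hessian it does: second differences at a small scale `t` see the
convexity of `F` (`EnvelopedBy.le_inner_hess`).

Optimisation: an accepted step lowers the empirical risk, hence raises `F` by at most `2 * η` over a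
whole stage, so iterates never leave the ball. Bounded backtracking and the Polyak–Łojasiewicz
inequality give linear convergence (`gdLoop_spec`). A small power of `B` steps is enough, and
affordable since sample sizes are at most of order `B ^ (1 - δ ^ J)`. As closeness is uniform on the
ball, reusing the data across stages is harmless.

Statistics: the gradient at the minimiser is centred with a moment of order `1 + α`, so truncation
and Chebyshev give its average the order `n ^ (-(α / (1 + α)))`, which matches the tolerance when `α
= α'`. -/

theorem le_add_deriv_add_of_second_deriv_le {φ φ' φ'' : ℝ → ℝ} {A : ℝ}
    (h1 : ∀ t, HasDerivAt φ (φ' t) t) (h2 : ∀ t, HasDerivAt φ' (φ'' t) t)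
    (hA : ∀ t ∈ Set.Icc (0 : ℝ) 1, φ'' t ≤ A) : φ 1 ≤ φ 0 + φ' 0 + A / 2 := by
  have hd1 : ∀ t, HasDerivAt (fun t => φ' t - A * t) (φ'' t - A) t := fun t =>
    ((h2 t).fun_sub ((hasDerivAt_id' t).const_mul A)).congr_deriv (by ring)
  have anti1 : AntitoneOn (fun t => φ' t - A * t) (Set.Icc 0 1) := by
    refine antitoneOn_of_deriv_nonpos (convex_Icc 0 1)
      (fun t _ => (hd1 t).continuousAt.continuousWithinAt)
      (fun t _ => (hd1 t).differentiableAt.differentiableWithinAt) fun t ht => ?_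
    rw [(hd1 t).deriv]
    linarith [hA t (interior_subset ht)]
  have hd0 : ∀ t, HasDerivAt (fun t => φ t - φ' 0 * t - A / 2 * t ^ 2) (φ' t - φ' 0 - A * t) t := by
    intro t
    refine (((h1 t).fun_sub ((hasDerivAt_id' t).const_mul (φ' 0))).fun_sub
      ((hasDerivAt_pow 2 t).const_mul (A / 2))).congr_deriv ?_
    norm_num
    ring
  have anti0 : AntitoneOn (fun t => φ t - φ' 0 * t - A / 2 * t ^ 2) (Set.Icc 0 1) := by
    refine antitoneOn_of_deriv_nonpos (convex_Icc 0 1)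
      (fun t _ => (hd0 t).continuousAt.continuousWithinAt)
      (fun t _ => (hd0 t).differentiableAt.differentiableWithinAt) fun t ht => ?_
    rw [(hd0 t).deriv]
    have ht' := interior_subset ht
    have := anti1 (Set.left_mem_Icc.2 zero_le_one) ht' ht'.1
    simp only [mul_zero, sub_zero] at this
    linarith
  have := anti0 (Set.left_mem_Icc.2 zero_le_one) (Set.right_mem_Icc.2 zero_le_one) zero_le_one
  norm_num at this
  linarith

variable {d : ℕ} {g F : Vec d → ℝ} {θ : Vec d} {ρ A c η : ℝ}

theorem contDiff_gradient (hg : ContDiff ℝ 2 g) : ContDiff ℝ 1 (gradient g) := by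
  have : ContDiff ℝ 1 (fderiv ℝ g) := hg.fderiv_right (by norm_num)
  exact (InnerProductSpace.toDual ℝ (Vec d)).symm.contDiff.comp this

theorem le_add_inner_gradient_of_hess_le (hg : ContDiff ℝ 2 g) {x u : Vec d} {A : ℝ}
    (hA : ∀ t ∈ Set.Icc (0 : ℝ) 1, ⟪fderiv ℝ (gradient g) (x + t • u) u, u⟫ ≤ A) :
    g (x + u) ≤ g x + ⟪gradient g x, u⟫ + A / 2 := by
  have hline : ∀ t : ℝ, HasDerivAt (fun t : ℝ => x + t • u) u t := fun t => by
    simpa using ((hasDerivAt_id t).smul_const u).const_add x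
  have h1 : ∀ t : ℝ, HasDerivAt (fun t : ℝ => g (x + t • u)) ⟪gradient g (x + t • u), u⟫ t := by
    intro t
    rw [inner_gradient_left]
    exact (hg.differentiable (by norm_num) _).hasFDerivAt.comp_hasDerivAt t (hline t)
  have h2 : ∀ t : ℝ, HasDerivAt (fun t : ℝ => ⟪gradient g (x + t • u), u⟫)
      ⟪fderiv ℝ (gradient g) (x + t • u) u, u⟫ t := by
    intro t
    have := (((contDiff_gradient hg).differentiable (by norm_num) _).hasFDerivAt.comp_hasDerivAt t
      (hline t)).inner ℝ (hasDerivAt_const t u)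
    simpa using this
  simpa using le_add_deriv_add_of_second_deriv_le h1 h2 hA

theorem add_inner_gradient_le_of_le_hess (hg : ContDiff ℝ 2 g) {x u : Vec d} {A : ℝ}
    (hA : ∀ t ∈ Set.Icc (0 : ℝ) 1, A ≤ ⟪fderiv ℝ (gradient g) (x + t • u) u, u⟫) :
    g x + ⟪gradient g x, u⟫ + A / 2 ≤ g (x + u) := by
  have hgrad : gradient (fun y => -g y) = fun y => -gradient g y := by
    ext1 y
    simp only [gradient, fderiv_fun_neg, map_neg]
  have hneg := le_add_inner_gradient_of_hess_le (A := -A) (x := x) (u := u) hg.neg fun t ht => by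
    rw [hgrad, fderiv_fun_neg]
    simpa using hA t ht
  rw [hgrad, inner_neg_left] at hneg
  linarith

/-! ### Functions with controlled derivatives on a ball -/

/-- On the closed ball of radius `ρ` around `θ`, the gradient and the Hessian of `g` are bounded by
`A` and the Hessian is `A`-Lipschitz. -/
def EnvelopedBy (g : Vec d → ℝ) (θ : Vec d) (ρ A : ℝ) : Prop :=
  ∀ x ∈ Metric.closedBall θ ρ, ‖gradient g x‖ ≤ A ∧ ‖fderiv ℝ (gradient g) x‖ ≤ A ∧
    ∀ y ∈ Metric.closedBall θ ρ,
      ‖fderiv ℝ (gradient g) x - fderiv ℝ (gradient g) y‖ ≤ A * ‖x - y‖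

theorem EnvelopedBy.mono {A' : ℝ} (h : EnvelopedBy g θ ρ A) (hA : A ≤ A') :
    EnvelopedBy g θ ρ A' := fun x hx =>
  ⟨(h x hx).1.trans hA, (h x hx).2.1.trans hA, fun y hy => ((h x hx).2.2 y hy).trans
    (mul_le_mul_of_nonneg_right hA (norm_nonneg _))⟩

theorem EnvelopedBy.abs_sub_le (h : EnvelopedBy g θ ρ A) (hg : ContDiff ℝ 2 g) {x y : Vec d}
    (hx : x ∈ Metric.closedBall θ ρ) (hy : y ∈ Metric.closedBall θ ρ) :
    |g x - g y| ≤ A * ‖x - y‖ := by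
  refine Convex.norm_image_sub_le_of_norm_fderiv_le (𝕜 := ℝ)
    (fun z _ => hg.differentiable (by norm_num) z) (fun z hz => ?_)
    (convex_closedBall θ ρ) hy hx
  rw [← toDual_gradient, LinearIsometryEquiv.norm_map]
  exact (h z hz).1

theorem add_smul_mem_closedBall {x u : Vec d} (hx : x ∈ Metric.closedBall θ ρ)
    (hxu : x + u ∈ Metric.closedBall θ ρ) {t : ℝ} (ht : t ∈ Set.Icc (0 : ℝ) 1) :
    x + t • u ∈ Metric.closedBall θ ρ :=
  (convex_closedBall θ ρ).add_smul_mem hx hxu ht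

/-- The second-order term is at most `v ^ 2 * A * ‖G‖ ^ 2 / 2`, so for `v * A ≤ 1` it eats at most
half of the first-order decrease `v * ‖G‖ ^ 2`. Convexity of the ball keeps the whole segment where
`A` is valid. -/
theorem EnvelopedBy.descent (h : EnvelopedBy g θ ρ A) (hg : ContDiff ℝ 2 g) {x : Vec d}
    (hx : x ∈ Metric.closedBall θ ρ) {v : ℝ} (hv : 0 ≤ v) (hvA : v * A ≤ 1)
    (hxv : x - v • gradient g x ∈ Metric.closedBall θ ρ) :
    g (x - v • gradient g x) ≤ g x - v / 2 * ‖gradient g x‖ ^ 2 := by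
  set G := gradient g x with hG
  have key := le_add_inner_gradient_of_hess_le (A := A * ‖v • G‖ ^ 2) (x := x) (u := -(v • G)) hg
    fun t ht => by
      have hmem : x + t • (-(v • G)) ∈ Metric.closedBall θ ρ :=
        add_smul_mem_closedBall hx (by rwa [← sub_eq_add_neg]) ht
      calc _ ≤ ‖fderiv ℝ (gradient g) (x + t • (-(v • G))) (-(v • G))‖ * ‖-(v • G)‖ :=
            real_inner_le_norm _ _
        _ ≤ (A * ‖-(v • G)‖) * ‖-(v • G)‖ := by
            gcongr
            exact ((fderiv ℝ (gradient g) _).le_opNorm _).trans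
              (mul_le_mul_of_nonneg_right (h _ hmem).2.1 (norm_nonneg _))
        _ = _ := by rw [norm_neg]; ring
  rw [← sub_eq_add_neg] at key
  refine key.trans ?_
  rw [← hG, inner_neg_right, real_inner_smul_right, real_inner_self_eq_norm_sq, norm_smul,
    Real.norm_of_nonneg hv]
  have : v * A * (v * ‖G‖ ^ 2) ≤ 1 * (v * ‖G‖ ^ 2) :=
    mul_le_mul_of_nonneg_right hvA (by positivity)
  nlinarith

/-! ### Strong convexity of a perturbation of a strongly convex function -/

/-- `F` is strongly convex with constant `c` on the set `S`. -/
def StrongConvexIneqOn (S : Set (Vec d)) (c : ℝ) (F : Vec d → ℝ) : Prop :=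
  ∀ a ∈ Set.Icc (0 : ℝ) 1, ∀ θ₁ ∈ S, ∀ θ₂ ∈ S,
    F (a • θ₁ + (1 - a) • θ₂) ≤
      a * F θ₁ + (1 - a) * F θ₂ - c / 2 * (a * (1 - a)) * ‖θ₁ - θ₂‖ ^ 2

/-- The second difference of `F` at scale `t` is at least `c * t ^ 2`; passing to `g` costs `4 * η`,
and replacing the second difference of `g` by its Hessian at `x` costs `A * t ^ 3`. The two
smallness conditions make each loss at most a quarter of the main term. -/
theorem EnvelopedBy.le_inner_hess (h : EnvelopedBy g θ (ρ + 1) A) (hg : ContDiff ℝ 2 g)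
    (hF : StrongConvexIneqOn (Metric.closedBall θ (ρ + 1)) c F)
    (hclose : ∀ x ∈ Metric.closedBall θ (ρ + 1), |g x - F x| ≤ η) {t : ℝ} (ht : 0 < t)
    (ht1 : t ≤ 1) (htA : A * t ≤ c / 4) (hη : 16 * η ≤ c * t ^ 2) {x : Vec d}
    (hx : x ∈ Metric.closedBall θ ρ) (u : Vec d) :
    c / 2 * ‖u‖ ^ 2 ≤ ⟪fderiv ℝ (gradient g) x u, u⟫ := by
  set H := fderiv ℝ (gradient g) with hH
  have hmem : ∀ w : Vec d, ‖w‖ ≤ 1 → x + w ∈ Metric.closedBall θ (ρ + 1) := fun w hw => by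
    rw [mem_closedBall_iff_norm] at hx ⊢
    calc ‖x + w - θ‖ = ‖(x - θ) + w‖ := by congr 1; abel
      _ ≤ ‖x - θ‖ + ‖w‖ := norm_add_le _ _
      _ ≤ ρ + 1 := add_le_add hx hw
  have hx' : x ∈ Metric.closedBall θ (ρ + 1) := by simpa using hmem 0 (by simp)
  have hA0 : 0 ≤ A := (norm_nonneg _).trans (h x hx').1
  have unit : ∀ w : Vec d, ‖w‖ = 1 → c / 2 ≤ ⟪H x w, w⟫ := by
    intro w hw
    have taylor : ∀ σ : ℝ, |σ| = 1 → g (x + σ • t • w) ≤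
        g x + ⟪gradient g x, σ • t • w⟫ + (t ^ 2 * (⟪H x w, w⟫ + A * t)) / 2 := by
      intro σ hσ
      refine le_add_inner_gradient_of_hess_le hg fun s hs => ?_
      have hnorm : ‖s • σ • t • w‖ ≤ t := by
        rw [norm_smul, norm_smul, norm_smul, hw, Real.norm_eq_abs σ, hσ, Real.norm_of_nonneg ht.le,
          Real.norm_of_nonneg hs.1]
        nlinarith [hs.2]
      have hdiff : ‖H (x + s • σ • t • w) - H x‖ ≤ A * t := by
        refine ((h _ (hmem _ (hnorm.trans ht1))).2.2 x hx').trans ?_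
        rw [add_sub_cancel_left]
        exact mul_le_mul_of_nonneg_left hnorm hA0
      have hin : ⟪(H (x + s • σ • t • w) - H x) w, w⟫ ≤ A * t := by
        calc _ ≤ ‖(H (x + s • σ • t • w) - H x) w‖ * ‖w‖ := real_inner_le_norm _ _
          _ ≤ ‖H (x + s • σ • t • w) - H x‖ * ‖w‖ * ‖w‖ := by
              gcongr; exact ContinuousLinearMap.le_opNorm _ _
          _ ≤ A * t := by rw [hw]; simpa using hdiff
      rw [sub_apply, inner_sub_left] at hin
      have hσ2 : σ * σ = 1 := by
        rw [← sq, ← sq_abs, hσ, one_pow]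
      calc ⟪H (x + s • σ • t • w) (σ • t • w), σ • t • w⟫
          = (σ * σ) * t ^ 2 * ⟪H (x + s • σ • t • w) w, w⟫ := by
            simp only [map_smul, real_inner_smul_left, real_inner_smul_right]; ring
        _ ≤ _ := by
            rw [hσ2, one_mul]
            exact mul_le_mul_of_nonneg_left (by linarith) (by positivity)
    have hp := taylor 1 (by simp)
    have hm := taylor (-1) (by simp)
    simp only [one_smul, neg_smul, inner_neg_right] at hp hm
    have htw : ‖t • w‖ ≤ 1 := by rw [norm_smul, hw, Real.norm_of_nonneg ht.le]; linarith
    have m1 := hmem (t • w) htw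
    have m2 := hmem (-(t • w)) (by rwa [norm_neg])
    -- `x` is the midpoint of `x ± t • w`; the gradient terms of `hp` and `hm` cancel when they are
    -- added.
    have hsc := hF (1 / 2) ⟨by norm_num, by norm_num⟩ _ m1 _ m2
    have e1 : (1 / 2 : ℝ) • (x + t • w) + (1 - 1 / 2 : ℝ) • (x + -(t • w)) = x := by
      module
    have e2 : ‖x + t • w - (x + -(t • w))‖ = 2 * t := by
      rw [show x + t • w - (x + -(t • w)) = (2 * t) • w by module, norm_smul, hw,
        Real.norm_of_nonneg (by positivity), mul_one]
    rw [e1, e2] at hsc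
    have c1 := abs_le.1 (hclose _ m1)
    have c2 := abs_le.1 (hclose _ m2)
    have c3 := abs_le.1 (hclose _ hx')
    have ht2 : 0 < t ^ 2 := by positivity
    have : c * t ^ 2 - 4 * η ≤ t ^ 2 * (⟪H x w, w⟫ + A * t) := by
      have : c / 2 * (1 / 2 * (1 - 1 / 2)) * (2 * t) ^ 2 = c * t ^ 2 / 2 := by ring
      linarith [c1.1, c1.2, c2.1, c2.2, c3.1, c3.2]
    have h3 : t ^ 2 * (3 / 4 * c) ≤ t ^ 2 * (⟪H x w, w⟫ + A * t) := by linarith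
    have := le_of_mul_le_mul_left h3 ht2
    linarith
  rcases eq_or_ne u 0 with rfl | hu
  · simp
  have hu' : 0 < ‖u‖ := norm_pos_iff.2 hu
  have := unit (‖u‖⁻¹ • u) (by rw [norm_smul, norm_inv, norm_norm, inv_mul_cancel₀ hu'.ne'])
  rw [map_smul, real_inner_smul_left, real_inner_smul_right, ← mul_assoc, ← mul_inv, ← sq,
    ← div_eq_inv_mul, le_div_iff₀ (by positivity)] at this
  exact this

/-- Uniform lower bound `c` on the Hessian of `g` over a ball. -/
def HessGEOn (g : Vec d → ℝ) (θ : Vec d) (ρ c : ℝ) : Prop :=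
  ∀ x ∈ Metric.closedBall θ ρ, ∀ u, c * ‖u‖ ^ 2 ≤ ⟪fderiv ℝ (gradient g) x u, u⟫

theorem HessGEOn.add_inner_le (h : HessGEOn g θ ρ c) (hg : ContDiff ℝ 2 g) {x y : Vec d}
    (hx : x ∈ Metric.closedBall θ ρ) (hy : y ∈ Metric.closedBall θ ρ) :
    g x + ⟪gradient g x, y - x⟫ + c * ‖y - x‖ ^ 2 / 2 ≤ g y := by
  have := add_inner_gradient_le_of_le_hess (x := x) (u := y - x) (A := c * ‖y - x‖ ^ 2) hg
    fun t ht => h _ (add_smul_mem_closedBall hx (by simpa using hy) ht) _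
  simpa using this

/-- Polyak–Łojasiewicz inequality: optimise the quadratic lower bound over `‖y - x‖`. The point `y`
is arbitrary in the ball, so no critical point of `g` is needed. -/
theorem HessGEOn.sub_le_sq_norm_gradient (h : HessGEOn g θ ρ c) (hc : 0 < c) (hg : ContDiff ℝ 2 g)
    {x y : Vec d} (hx : x ∈ Metric.closedBall θ ρ) (hy : y ∈ Metric.closedBall θ ρ) :
    2 * c * (g x - g y) ≤ ‖gradient g x‖ ^ 2 := by
  have h1 := h.add_inner_le hg hx hy
  have h2 := (abs_le.1 (abs_real_inner_le_norm (gradient g x) (y - x))).1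
  have h3 : g x - g y ≤ ‖gradient g x‖ * ‖y - x‖ - c * ‖y - x‖ ^ 2 / 2 := by linarith
  have := mul_le_mul_of_nonneg_left h3 (by positivity : 0 ≤ 2 * c)
  nlinarith [sq_nonneg (‖gradient g x‖ - c * ‖y - x‖)]

/-- Strong monotonicity of the gradient, from adding the first-order bounds at `x` and at `θ`. Here
`θ` will be the minimiser of `F`, not of `g`, whence the second gradient. -/
theorem HessGEOn.norm_sub_le (h : HessGEOn g θ ρ c) (hg : ContDiff ℝ 2 g) (hρ : 0 ≤ ρ)
    {x : Vec d} (hx : x ∈ Metric.closedBall θ ρ) :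
    c * ‖x - θ‖ ≤ ‖gradient g x‖ + ‖gradient g θ‖ := by
  have hθ : θ ∈ Metric.closedBall θ ρ := Metric.mem_closedBall_self hρ
  have h1 := h.add_inner_le hg hx hθ
  have h2 := h.add_inner_le hg hθ hx
  have h3 := real_inner_le_norm (gradient g x) (x - θ)
  have h4 := (abs_le.1 (abs_real_inner_le_norm (gradient g θ) (x - θ))).1
  rw [← neg_sub x θ, inner_neg_right, norm_neg] at h1
  rcases (norm_nonneg (x - θ)).eq_or_lt with h0 | h0
  · rw [← h0, mul_zero]; positivity
  · refine le_of_mul_le_mul_right ?_ h0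
    nlinarith

end NoisyOpt

namespace NoisyOpt

/-! ### Gradient descent with backtracking line search -/

variable {d : ℕ} {g F : Vec d → ℝ} {θ : Vec d} {R A₁ A c η β τ : ℝ} {ce cg k₀ : ℕ}

/-- The sufficient decrease condition of the line search. -/
def SufficientDecrease (g : Vec d → ℝ) (x G : Vec d) (v : ℝ) : Prop :=
  g (x - v • G) ≤ g x - v / 2 * ‖G‖ ^ 2

/-- The step `β ^ k₀` is known to be acceptable, so from exponent `i` at most `m = k₀ - i` further
evaluations are made; a budget covering them rules out a stop for lack of money. -/
theorem backtrack_spec (hce : 0 < ce) {x G : Vec d} (hdec : SufficientDecrease g x G (β ^ k₀)) :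
    ∀ m i b : ℕ, i + m = k₀ → m * ce ≤ b →
      ∃ i', i' ≤ k₀ ∧ (backtrack ce g β x G (β ^ i) b).1 = β ^ i' ∧
        SufficientDecrease g x G (β ^ i') ∧ b ≤ (backtrack ce g β x G (β ^ i) b).2 + m * ce := by
  intro m
  induction m with
  | zero =>
    intro i b hi _
    obtain rfl : i = k₀ := by simpa using hi
    refine ⟨i, le_rfl, ?_, hdec, ?_⟩ <;> rw [backtrack, dif_neg] <;>
      first | exact fun h => absurd hdec (not_le.2 h.2.2) | simp
  | succ m ih =>
    intro i b hi hb
    rw [add_mul, one_mul] at hb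
    by_cases h : SufficientDecrease g x G (β ^ i)
    · refine ⟨i, by omega, ?_, h, ?_⟩ <;> rw [backtrack, dif_neg] <;>
        first | exact fun h' => absurd h (not_le.2 h'.2.2) | simp
    · obtain ⟨i', h1, h2, h3, h4⟩ := ih (i + 1) (b - ce) (by omega) (by omega)
      have hrec : backtrack ce g β x G (β ^ i) b = backtrack ce g β x G (β ^ (i + 1)) (b - ce) := by
        rw [backtrack, dif_pos ⟨hce, by omega, not_le.1 h⟩, pow_succ']
      rw [hrec]
      refine ⟨i', h1, h2, h3, ?_⟩
      rw [add_mul, one_mul]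
      omega

/-- Induction on the number `N` of steps still allowed: each accepted step contracts the gap `g x -
m` by `1 - β ^ k₀ * c` and costs at most `k₀ + 1` evaluations and one gradient. -/
theorem gdLoop_spec (hce : 0 < ce) (hβ : β ∈ Set.Ioo (0 : ℝ) 1) (hτ : 0 < τ) {S : Set (Vec d)}
    {m : ℝ} (hc : 0 ≤ c)
    (hstep : ∀ x ∈ S, ∀ i, SufficientDecrease g x (gradient g x) (β ^ i) →
      x - β ^ i • gradient g x ∈ S)
    (hdec : ∀ x ∈ S, SufficientDecrease g x (gradient g x) (β ^ k₀))
    (hm : ∀ x ∈ S, m ≤ g x) (hPL : ∀ x ∈ S, 2 * c * (g x - m) ≤ ‖gradient g x‖ ^ 2) :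
    ∀ (N : ℕ) (x : Vec d) (b : ℕ), x ∈ S →
      (1 - β ^ k₀ * c) ^ N * (g x - m) ≤ β ^ k₀ / 2 * τ ^ 2 →
      N * ((k₀ + 1) * ce + cg) ≤ b →
      (gdLoop ce cg g τ β x (gradient g x) b).1 ∈ S ∧
        ‖gradient g (gdLoop ce cg g τ β x (gradient g x) b).1‖ ≤ τ ∧
        b ≤ (gdLoop ce cg g τ β x (gradient g x) b).2 + N * ((k₀ + 1) * ce + cg) := by
  have hβk : ∀ i, 0 < β ^ i := fun i => pow_pos hβ.1 i
  intro N
  induction N with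
  | zero =>
    intro x b hx hN _
    -- A step `β ^ k₀`, although not made, would lower `g` by `β ^ k₀ / 2 * ‖G‖ ^ 2` without going
    -- below `m`; so a small gap forces a small gradient.
    have hG : ‖gradient g x‖ ≤ τ := by
      have h1 : SufficientDecrease g x (gradient g x) (β ^ k₀) := hdec x hx
      have h2 := hm _ (hstep x hx k₀ h1)
      rw [SufficientDecrease] at h1
      have h3 : β ^ k₀ / 2 * ‖gradient g x‖ ^ 2 ≤ β ^ k₀ / 2 * τ ^ 2 := by
        rw [pow_zero, one_mul] at hN
        linarith
      exact le_of_sq_le_sq (le_of_mul_le_mul_left h3 (half_pos (hβk k₀))) hτ.le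
    rw [gdLoop, dif_neg (fun h => absurd hG (not_le.2 h.2.1))]
    exact ⟨hx, hG, by simp⟩
  | succ N ih =>
    intro x b hx hN hb
    have hb' : N * ((k₀ + 1) * ce + cg) + (k₀ * ce + ce + cg) ≤ b := by
      refine le_trans (le_of_eq ?_) hb
      ring
    by_cases hG : ‖gradient g x‖ ≤ τ
    · rw [gdLoop, dif_neg (fun h => absurd hG (not_le.2 h.2.1))]
      exact ⟨hx, hG, by simp⟩
    obtain ⟨i, hi, h1, h2, h3⟩ := backtrack_spec hce (hdec x hx) k₀ 0 (b - ce) (zero_add _)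
      (by omega)
    rw [pow_zero] at h1 h3
    set r := backtrack ce g β x (gradient g x) 1 (b - ce) with hr
    have hcg : cg ≤ r.2 := by omega
    have hrec : gdLoop ce cg g τ β x (gradient g x) b =
        gdLoop ce cg g τ β (x - β ^ i • gradient g x) (gradient g (x - β ^ i • gradient g x))
          (r.2 - cg) := by
      rw [gdLoop, dif_pos ⟨hce, not_le.1 hG, by omega⟩]
      simp only [← hr, h1]
      rw [if_pos (show g _ ≤ g x - β ^ i / 2 * _ from h2), if_pos hcg]
    have hxS := hstep x hx i h2
    have hcontr : g (x - β ^ i • gradient g x) - m ≤ (1 - β ^ k₀ * c) * (g x - m) := by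
      have hle : β ^ k₀ ≤ β ^ i := pow_le_pow_of_le_one hβ.1.le hβ.2.le hi
      have hPLx := hPL x hx
      have h0 : 0 ≤ c * (g x - m) := mul_nonneg hc (sub_nonneg.2 (hm x hx))
      have e1 : β ^ i * (c * (g x - m)) ≤ β ^ i / 2 * ‖gradient g x‖ ^ 2 := by
        nlinarith [hβk i]
      have e2 := mul_le_mul_of_nonneg_right hle h0
      have h2' : g (x - β ^ i • gradient g x) ≤ g x - β ^ i / 2 * ‖gradient g x‖ ^ 2 := h2
      linarith
    have hN' : (1 - β ^ k₀ * c) ^ N * (g (x - β ^ i • gradient g x) - m) ≤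
        β ^ k₀ / 2 * τ ^ 2 := by
      -- If the contraction factor is negative, the new gap is both nonnegative and at most zero.
      by_cases hq : 0 ≤ 1 - β ^ k₀ * c
      · refine le_trans (mul_le_mul_of_nonneg_left hcontr (pow_nonneg hq N)) ?_
        rwa [← mul_assoc, ← pow_succ]
      · have hzero : g (x - β ^ i • gradient g x) - m = 0 := by
          refine le_antisymm (hcontr.trans ?_) (sub_nonneg.2 (hm _ hxS))
          exact mul_nonpos_of_nonpos_of_nonneg (not_le.1 hq).le (sub_nonneg.2 (hm x hx))
        rw [hzero, mul_zero]
        have := hβk k₀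
        positivity
    obtain ⟨r1, r2, r3⟩ := ih _ (r.2 - cg) hxS hN' (by omega)
    rw [hrec]
    refine ⟨r1, r2, ?_⟩
    have : (N + 1) * ((k₀ + 1) * ce + cg) =
      N * ((k₀ + 1) * ce + cg) + (k₀ * ce + ce + cg) := by ring
    omega

theorem gdBls_eq_gdLoop {x₀ : Vec d} {b : ℕ} (hb : cg + ce ≤ b) :
    gdBls ce cg g x₀ b τ β = gdLoop ce cg g τ β x₀ (gradient g x₀) (b - (cg + ce)) := by
  have h1 : cg ≤ b := by omega
  have h2 : ce ≤ b - cg := by omega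
  simp only [gdBls, if_pos h1, if_pos h2, Nat.sub_sub]

/-- A step has length at most `A₁`, so it lands in the larger ball; as it does not increase `g`,
`hsub` sends it back to the small one. Hence the part of the sublevel set of `x₀` in the small ball
is invariant. -/
theorem gdBls_spec (hce : 0 < ce) (hβ : β ∈ Set.Ioo (0 : ℝ) 1) (hτ : 0 < τ) (hc : 0 < c)
    (hg : ContDiff ℝ 2 g) (henv₁ : EnvelopedBy g θ R A₁) (henv : EnvelopedBy g θ (R + A₁ + 1) A)
    (hhess : HessGEOn g θ R c) {x₀ : Vec d} (hx₀ : x₀ ∈ Metric.closedBall θ R)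
    (hsub : ∀ x ∈ Metric.closedBall θ (R + A₁ + 1), g x ≤ g x₀ → x ∈ Metric.closedBall θ R)
    (hkA : β ^ k₀ * A ≤ 1) (hkc : β ^ k₀ * c ≤ 1) {N b : ℕ}
    (hN : (1 - β ^ k₀ * c) ^ N * A₁ ^ 2 ≤ β ^ k₀ * c * τ ^ 2)
    (hb : cg + ce + N * ((k₀ + 1) * ce + cg) ≤ b) :
    (gdBls ce cg g x₀ b τ β).1 ∈ Metric.closedBall θ R ∧
      g (gdBls ce cg g x₀ b τ β).1 ≤ g x₀ ∧
      ‖gradient g (gdBls ce cg g x₀ b τ β).1‖ ≤ τ ∧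
      b ≤ (gdBls ce cg g x₀ b τ β).2 + (cg + ce + N * ((k₀ + 1) * ce + cg)) := by
  obtain ⟨y, hy, hmin⟩ := (isCompact_closedBall θ R).exists_isMinOn ⟨x₀, hx₀⟩
    hg.continuous.continuousOn
  have hA₁ : 0 ≤ A₁ := (norm_nonneg _).trans (henv₁ x₀ hx₀).1
  have hmem : ∀ x ∈ Metric.closedBall θ R, ∀ i : ℕ,
      x - β ^ i • gradient g x ∈ Metric.closedBall θ (R + A₁ + 1) := fun x hx i => by
    have hgrad := (henv₁ x hx).1
    rw [mem_closedBall_iff_norm] at hx ⊢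
    have hpow : β ^ i ≤ 1 := pow_le_one₀ hβ.1.le hβ.2.le
    have hpow0 : 0 ≤ β ^ i := pow_nonneg hβ.1.le i
    calc ‖x - β ^ i • gradient g x - θ‖ = ‖(x - θ) - β ^ i • gradient g x‖ := by congr 1; abel
      _ ≤ ‖x - θ‖ + ‖β ^ i • gradient g x‖ := norm_sub_le _ _
      _ ≤ R + 1 * A₁ := by
          rw [norm_smul, Real.norm_of_nonneg hpow0]
          gcongr
      _ ≤ R + A₁ + 1 := by linarith
  have hbig : ∀ x ∈ Metric.closedBall θ R, x ∈ Metric.closedBall θ (R + A₁ + 1) := fun x hx =>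
    Metric.closedBall_subset_closedBall (by linarith) hx
  have hPL : ∀ x ∈ Metric.closedBall θ R, 2 * c * (g x - g y) ≤ ‖gradient g x‖ ^ 2 :=
    fun x hx => hhess.sub_le_sq_norm_gradient hc hg hx hy
  rw [gdBls_eq_gdLoop (by omega)]
  -- The initial gap is at most `A₁ ^ 2 / (2 * c)`, by the Polyak–Łojasiewicz inequality at `x₀`.
  have hN' : (1 - β ^ k₀ * c) ^ N * (g x₀ - g y) ≤ β ^ k₀ / 2 * τ ^ 2 := by
    have h1 : 2 * c * (g x₀ - g y) ≤ A₁ ^ 2 :=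
      (hPL x₀ hx₀).trans (pow_le_pow_left₀ (norm_nonneg _) (henv₁ x₀ hx₀).1 2)
    have h2 := mul_le_mul_of_nonneg_left h1 (pow_nonneg (sub_nonneg.2 hkc) N)
    refine le_of_mul_le_mul_left ?_ (by positivity : 0 < 2 * c)
    calc _ = (1 - β ^ k₀ * c) ^ N * (2 * c * (g x₀ - g y)) := by ring
      _ ≤ _ := h2.trans hN
      _ = _ := by ring
  obtain ⟨h1, h2, h3⟩ := gdLoop_spec (cg := cg) (S := {x ∈ Metric.closedBall θ R | g x ≤ g x₀})
    (m := g y) (k₀ := k₀) hce hβ hτ hc.le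
    (fun x hx i hi => by
      have hle : g (x - β ^ i • gradient g x) ≤ g x₀ := by
        refine (le_trans hi ?_).trans hx.2
        have : 0 ≤ β ^ i := pow_nonneg hβ.1.le i
        have : 0 ≤ β ^ i / 2 * ‖gradient g x‖ ^ 2 := by positivity
        linarith
      exact ⟨hsub _ (hmem x hx.1 i) hle, hle⟩)
    (fun x hx => henv.descent hg (hbig x hx.1) (pow_nonneg hβ.1.le _) hkA (hmem x hx.1 k₀))
    (fun x hx => hmin hx.1) (fun x hx => hPL x hx.1) N x₀ (b - (cg + ce)) ⟨hx₀, le_rfl⟩ hN'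
    (by omega)
  exact ⟨h1.1, h1.2, h2, by omega⟩

/-! ### The multi-stage algorithm -/

/-- `g` is uniformly `η`-close to `F` on the ball of radius `R + A₁ + 1` around `θ`, and its
derivatives are controlled by `A₁` on the ball of radius `R` and by `A` on the larger ball. -/
structure GoodApprox (F g : Vec d → ℝ) (θ : Vec d) (R A₁ A η : ℝ) : Prop where
  contDiff : ContDiff ℝ 2 g
  env_small : EnvelopedBy g θ R A₁
  env : EnvelopedBy g θ (R + A₁ + 1) A
  close : ∀ x ∈ Metric.closedBall θ (R + A₁ + 1), |g x - F x| ≤ η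

/-- Compatibility of the constants of the analysis: `F` is strongly convex on the large ball, `t` is
the scale at which second differences of `F` dominate an `η`-perturbation of it, and the step size
`β ^ k₀` is always accepted by the line search. -/
structure Constants (F : Vec d → ℝ) (θ : Vec d) (R A₁ A c η t β : ℝ) (k₀ : ℕ) : Prop where
  R_nonneg : 0 ≤ R
  A₁_nonneg : 0 ≤ A₁
  c_pos : 0 < c
  convex : StrongConvexIneqOn (Metric.closedBall θ (R + A₁ + 1)) c F
  t_pos : 0 < t
  t_le_one : t ≤ 1
  A_mul_t_le : A * t ≤ c / 4
  η_nonneg : 0 ≤ η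
  η_le : 16 * η ≤ c * t ^ 2
  β_mem : β ∈ Set.Ioo (0 : ℝ) 1
  pow_mul_A : β ^ k₀ * A ≤ 1
  pow_mul_c : β ^ k₀ * c ≤ 1

theorem GoodApprox.hessGEOn {t : ℝ} (h : GoodApprox F g θ R A₁ A η)
    (hC : Constants F θ R A₁ A c η t β k₀) : HessGEOn g θ R (c / 2) := by
  have hsub : Metric.closedBall θ (R + 1) ⊆ Metric.closedBall θ (R + A₁ + 1) :=
    Metric.closedBall_subset_closedBall (by linarith [hC.A₁_nonneg])
  have henv : EnvelopedBy g θ (R + 1) A := fun x hx =>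
    ⟨(h.env x (hsub hx)).1, (h.env x (hsub hx)).2.1, fun y hy => (h.env x (hsub hx)).2.2 y (hsub hy)⟩
  exact fun x hx u => henv.le_inner_hess h.contDiff
    (fun a ha x hx y hy => hC.convex a ha x (hsub hx) y (hsub hy))
    (fun x hx => h.close x (hsub hx)) hC.t_pos hC.t_le_one hC.A_mul_t_le hC.η_le hx u

/-- Sublevel sets of `g` are traded for those of `F` at the price `2 * η`, one `η` at each end; this
makes the conclusion usable by the next stage, whose objective differs. -/
theorem GoodApprox.gdBls_spec {t ℓ : ℝ} (h : GoodApprox F g θ R A₁ A η)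
    (hC : Constants F θ R A₁ A c η t β k₀) (hce : 0 < ce) (hτ : 0 < τ) {x₀ : Vec d}
    (hx₀ : x₀ ∈ Metric.closedBall θ R) (hFx₀ : F x₀ + 2 * η ≤ ℓ)
    (hlevel : ∀ x, F x ≤ ℓ → x ∈ Metric.closedBall θ R) {N b : ℕ}
    (hN : (1 - β ^ k₀ * (c / 2)) ^ N * A₁ ^ 2 ≤ β ^ k₀ * (c / 2) * τ ^ 2)
    (hb : cg + ce + N * ((k₀ + 1) * ce + cg) ≤ b) :
    (gdBls ce cg g x₀ b τ β).1 ∈ Metric.closedBall θ R ∧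
      F (gdBls ce cg g x₀ b τ β).1 ≤ F x₀ + 2 * η ∧
      ‖gradient g (gdBls ce cg g x₀ b τ β).1‖ ≤ τ ∧
      b ≤ (gdBls ce cg g x₀ b τ β).2 + (cg + ce + N * ((k₀ + 1) * ce + cg)) := by
  have hbig : ∀ x ∈ Metric.closedBall θ R, x ∈ Metric.closedBall θ (R + A₁ + 1) := fun x hx =>
    Metric.closedBall_subset_closedBall (by linarith [hC.A₁_nonneg]) hx
  have hF : ∀ x ∈ Metric.closedBall θ (R + A₁ + 1), g x ≤ g x₀ → F x ≤ F x₀ + 2 * η := by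
    intro x hx hgx
    linarith [(abs_le.1 (h.close x hx)).1, (abs_le.1 (h.close x₀ (hbig x₀ hx₀))).2]
  have hc := hC.c_pos
  have hkc : β ^ k₀ * (c / 2) ≤ 1 := by
    have := mul_nonneg (pow_nonneg hC.β_mem.1.le k₀) hc.le
    linarith [hC.pow_mul_c]
  obtain ⟨h1, h2, h3, h4⟩ := NoisyOpt.gdBls_spec hce hC.β_mem hτ (half_pos hc) h.contDiff
    h.env_small h.env (h.hessGEOn hC) hx₀
    (fun x hx hgx => hlevel x ((hF x hx hgx).trans hFx₀)) hC.pow_mul_A hkc hN hb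
  exact ⟨h1, hF _ (hbig _ h1) h2, h3, h4⟩

/-- The sample size of the `j`-th stage. -/
noncomputable def stageSize (κ δ : ℝ) (B j : ℕ) : ℕ := ⌈κ * (B : ℝ) ^ (1 - δ ^ j)⌉₊

/-- The tolerance of the `j`-th stage. -/
noncomputable def stageTol (α' τ δ : ℝ) (B j : ℕ) : ℝ := τ * (B : ℝ) ^ (-(α' / (1 + α') * (1 - δ ^ j)))

/-- An upper bound on the cost of a call of GD-BLS with sample size `n` which makes at most `N`
steps. -/
def stageCost (Ceval Cgrad k₀ N n : ℕ) : ℕ :=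
  n * Cgrad + n * Ceval + N * ((k₀ + 1) * (n * Ceval) + n * Cgrad)

/-- Each stage raises `F` by at most `2 * η` and spends at most `W`, so before every stage the
iterate is still in the ball and at least `W` is left. -/
theorem multiStage_spec {𝓩 : Type*} {f : Vec d → 𝓩 → ℝ} {z : ℕ → 𝓩} {θ₀ : Vec d} {J B N W : ℕ}
    {Ceval Cgrad : ℕ} {α' δ κ t : ℝ} (hC : Constants F θ R A₁ A c η t β k₀) (hCeval : 0 < Ceval)
    (hlevel : ∀ x, F x ≤ F θ₀ + 2 * J * η → x ∈ Metric.closedBall θ R)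
    (hgood : ∀ j ∈ Finset.Icc 1 J, GoodApprox F (empRisk f z (stageSize κ δ B j)) θ R A₁ A η)
    (hpos : ∀ j ∈ Finset.Icc 1 J, 0 < stageSize κ δ B j)
    (hτ : ∀ j ∈ Finset.Icc 1 J, 0 < stageTol α' τ δ B j)
    (hN : ∀ j ∈ Finset.Icc 1 J, (1 - β ^ k₀ * (c / 2)) ^ N * A₁ ^ 2 ≤
      β ^ k₀ * (c / 2) * stageTol α' τ δ B j ^ 2)
    (hW : ∀ j ∈ Finset.Icc 1 J, stageCost Ceval Cgrad k₀ N (stageSize κ δ B j) ≤ W)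
    (hB : J * W ≤ B) :
    ∀ j ≤ J,
      (multiStage Ceval Cgrad f z θ₀ B α' δ κ τ β j).1 ∈ Metric.closedBall θ R ∧
      F (multiStage Ceval Cgrad f z θ₀ B α' δ κ τ β j).1 ≤ F θ₀ + 2 * j * η ∧
      B ≤ (multiStage Ceval Cgrad f z θ₀ B α' δ κ τ β j).2 + j * W ∧
      (1 ≤ j → ‖gradient (empRisk f z (stageSize κ δ B j))
        (multiStage Ceval Cgrad f z θ₀ B α' δ κ τ β j).1‖ ≤ stageTol α' τ δ B j) := by
  intro j
  have hη := hC.η_nonneg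
  induction j with
  | zero =>
    intro _
    simp only [multiStage]
    refine ⟨hlevel θ₀ ?_, by simp, by simp, by simp⟩
    have : 0 ≤ 2 * J * η := by positivity
    linarith
  | succ j ih =>
    intro hj
    obtain ⟨h1, h2, h3, -⟩ := ih (by omega)
    have hmem : j + 1 ∈ Finset.Icc 1 J := Finset.mem_Icc.2 ⟨by omega, hj⟩
    set s := multiStage Ceval Cgrad f z θ₀ B α' δ κ τ β j with hs
    set n := stageSize κ δ B (j + 1) with hn
    have hWn : stageCost Ceval Cgrad k₀ N n ≤ W := hW _ hmem
    have hcost : stageCost Ceval Cgrad k₀ N n ≤ s.2 := by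
      have : (j + 1) * W ≤ J * W := Nat.mul_le_mul_right W hj
      rw [add_mul, one_mul] at this
      omega
    have hce : 0 < n * Ceval := Nat.mul_pos (hpos _ hmem) hCeval
    have hs2 : 0 < s.2 := by
      refine lt_of_lt_of_le ?_ hcost
      unfold stageCost
      omega
    have hrec : multiStage Ceval Cgrad f z θ₀ B α' δ κ τ β (j + 1) =
        gdBls (n * Ceval) (n * Cgrad) (empRisk f z n) s.1 s.2 (stageTol α' τ δ B (j + 1)) β := by
      simp only [multiStage, ← hs, if_pos hs2]
      rfl
    rw [hrec]
    have hFle : F s.1 + 2 * η ≤ F θ₀ + 2 * (j + 1 : ℕ) * η := by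
      push_cast
      linarith
    have hFJ : F s.1 + 2 * η ≤ F θ₀ + 2 * J * η := by
      refine hFle.trans ?_
      have : ((j + 1 : ℕ) : ℝ) ≤ J := by exact_mod_cast hj
      gcongr
    obtain ⟨r1, r2, r3, r4⟩ := (hgood _ hmem).gdBls_spec hC hce (hτ _ hmem) h1 hFJ hlevel
      (hN _ hmem) hcost
    refine ⟨r1, r2.trans hFle, ?_, fun _ => r3⟩
    rw [add_mul, one_mul]
    unfold stageCost at hWn
    rw [← hn] at r4
    omega

end NoisyOpt

namespace NoisyOpt

/-! ### The budget suffices -/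

theorem stageCost_le (Ceval Cgrad k₀ N n : ℕ) :
    stageCost Ceval Cgrad k₀ N n ≤ (N + 1) * n * ((k₀ + 1) * Ceval + Cgrad) := by
  unfold stageCost
  have : (N + 1) * n * ((k₀ + 1) * Ceval + Cgrad) =
    n * Cgrad + n * Ceval + N * ((k₀ + 1) * (n * Ceval) + n * Cgrad) + k₀ * (n * Ceval) := by ring
  omega

theorem tendsto_natCast_rpow {s : ℝ} (hs : 0 < s) :
    Tendsto (fun B : ℕ => (B : ℝ) ^ s) atTop atTop :=
  (tendsto_rpow_atTop hs).comp tendsto_natCast_atTop_atTop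

/-- The largest sample has order `B ^ (1 - δ ^ J)`, leaving a slack of `B ^ (δ ^ J)`. One half of
this exponent pays for `⌈B ^ s⌉₊` steps, enough for the exponential to beat the factor `B`; the
other half absorbs the constants. -/
theorem eventually_exists_number_of_steps {b K κ δ : ℝ} (hb : 0 < b) (hK : 0 < K) (hκ : 0 < κ)
    (hδ : δ ∈ Set.Ioo (0 : ℝ) 1) (D : ℝ) (J Ceval Cgrad k₀ : ℕ) :
    ∀ᶠ B : ℕ in atTop, ∃ N W : ℕ, Real.exp (-b * N) * D ^ 2 * B ≤ K ∧
      (∀ j ∈ Finset.Icc 1 J, stageCost Ceval Cgrad k₀ N (stageSize κ δ B j) ≤ W) ∧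
      J * W ≤ B := by
  set s : ℝ := δ ^ J / 2 with hs
  have hs0 : 0 < s := half_pos (pow_pos hδ.1 J)
  set C₀ : ℕ := (k₀ + 1) * Ceval + Cgrad with hC₀
  have h1 : Tendsto (fun B : ℕ => D ^ 2 * (((B : ℝ) ^ s) ^ (1 / s) *
      Real.exp (-b * (B : ℝ) ^ s))) atTop (𝓝 (D ^ 2 * 0)) :=
    ((tendsto_rpow_mul_exp_neg_mul_atTop_nhds_zero (1 / s) b hb).comp
      (tendsto_natCast_rpow hs0)).const_mul _
  rw [mul_zero] at h1
  -- The `3` comes from `⌈B ^ s⌉₊ + 1 ≤ 3 * B ^ s`, and `κ + 1` from `⌈κ * x⌉₊ ≤ (κ + 1) * x` for `x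
  -- ≥ 1`.
  filter_upwards [h1.eventually (gt_mem_nhds hK), eventually_ge_atTop 1,
    (tendsto_natCast_rpow hs0).eventually_ge_atTop (3 * J * C₀ * (κ + 1))] with B hB hB1 hBC
  have hB1' : (1 : ℝ) ≤ B := by exact_mod_cast hB1
  have hB0 : (0 : ℝ) < B := by linarith
  have hBs : 1 ≤ (B : ℝ) ^ s := Real.one_le_rpow hB1' hs0.le
  have hceil : (⌈(B : ℝ) ^ s⌉₊ : ℝ) ≤ (B : ℝ) ^ s + 1 := (Nat.ceil_lt_add_one (by linarith)).le
  have hγ : 0 ≤ 1 - δ ^ J := sub_nonneg.2 (pow_le_one₀ hδ.1.le hδ.2.le)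
  have hfl : 0 ≤ (κ + 1) * (B : ℝ) ^ (1 - δ ^ J) := by positivity
  refine ⟨⌈(B : ℝ) ^ s⌉₊, (⌈(B : ℝ) ^ s⌉₊ + 1) * ⌊(κ + 1) * (B : ℝ) ^ (1 - δ ^ J)⌋₊ * C₀,
    ?_, fun j hj => ?_, ?_⟩
  · have h2 : Real.exp (-b * ⌈(B : ℝ) ^ s⌉₊) ≤ Real.exp (-b * (B : ℝ) ^ s) := by
      apply Real.exp_le_exp.2
      have := Nat.le_ceil ((B : ℝ) ^ s)
      nlinarith
    have h3 : ((B : ℝ) ^ s) ^ (1 / s) = B := by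
      rw [← Real.rpow_mul hB0.le, mul_one_div_cancel hs0.ne', Real.rpow_one]
    rw [h3] at hB
    calc _ ≤ Real.exp (-b * (B : ℝ) ^ s) * D ^ 2 * B := by gcongr
      _ = D ^ 2 * (B * Real.exp (-b * (B : ℝ) ^ s)) := by ring
      _ ≤ K := hB.le
  · refine (stageCost_le _ _ _ _ _).trans ?_
    gcongr
    apply Nat.le_floor
    have hj' := (Finset.mem_Icc.1 hj).2
    have hpow : δ ^ J ≤ δ ^ j := pow_le_pow_of_le_one hδ.1.le hδ.2.le hj'
    have hle : (B : ℝ) ^ (1 - δ ^ j) ≤ (B : ℝ) ^ (1 - δ ^ J) :=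
      Real.rpow_le_rpow_of_exponent_le hB1' (by linarith)
    have hone : 1 ≤ (B : ℝ) ^ (1 - δ ^ J) := Real.one_le_rpow hB1' hγ
    have := (Nat.ceil_lt_add_one (a := κ * (B : ℝ) ^ (1 - δ ^ j)) (by positivity)).le
    rw [stageSize]
    nlinarith
  · have hfloor := Nat.floor_le hfl
    have hreal : ((J * ((⌈(B : ℝ) ^ s⌉₊ + 1) * ⌊(κ + 1) * (B : ℝ) ^ (1 - δ ^ J)⌋₊ * C₀) : ℕ) : ℝ)
        ≤ B := by
      push_cast
      calc _ ≤ (J : ℝ) * ((3 * (B : ℝ) ^ s) * ((κ + 1) * (B : ℝ) ^ (1 - δ ^ J)) * C₀) := by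
            gcongr
            linarith
        _ = (3 * J * C₀ * (κ + 1)) * ((B : ℝ) ^ s * (B : ℝ) ^ (1 - δ ^ J)) := by ring
        _ ≤ (B : ℝ) ^ s * ((B : ℝ) ^ s * (B : ℝ) ^ (1 - δ ^ J)) := by gcongr
        _ = B := by
            rw [← Real.rpow_add hB0, ← Real.rpow_add hB0,
              show s + (s + (1 - δ ^ J)) = 1 by rw [hs]; ring, Real.rpow_one]
    exact_mod_cast hreal

variable {d : ℕ} {F : Vec d → ℝ} {θ : Vec d} {R A₁ A c η β : ℝ} {k₀ : ℕ}

/-- Since `α' / (1 + α') ≤ 1 / 2`, no tolerance decays faster than `B ^ (-1 / 2)`; one number of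
steps thus serves all stages. -/
theorem le_stageTol_sq {α' τ δ : ℝ} (hα' : α' ∈ Set.Ioc (0 : ℝ) 1) (hδ : δ ∈ Set.Ioo (0 : ℝ) 1)
    {B : ℕ} (hB : 1 ≤ B) (j : ℕ) : τ ^ 2 ≤ stageTol α' τ δ B j ^ 2 * B := by
  have hB1 : (1 : ℝ) ≤ B := by exact_mod_cast hB
  have hB0 : (0 : ℝ) < B := by linarith
  have ha : α' / (1 + α') ≤ 1 / 2 := by
    rw [div_le_div_iff₀ (by linarith [hα'.1]) two_pos]
    linarith [hα'.2]
  have ha0 : 0 ≤ α' / (1 + α') := div_nonneg hα'.1.le (by linarith [hα'.1])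
  have hγ : 0 ≤ 1 - δ ^ j := sub_nonneg.2 (pow_le_one₀ hδ.1.le hδ.2.le)
  have hγ1 : 1 - δ ^ j ≤ 1 := by linarith [pow_pos hδ.1 j]
  have hexp : α' / (1 + α') * (1 - δ ^ j) ≤ 1 / 2 := by nlinarith
  have : 1 ≤ ((B : ℝ) ^ (-(α' / (1 + α') * (1 - δ ^ j)))) ^ 2 * B := by
    rw [← Real.rpow_natCast, ← Real.rpow_mul hB0.le]
    nth_rw 2 [← Real.rpow_one (B : ℝ)]
    rw [← Real.rpow_add hB0]
    apply Real.one_le_rpow hB1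
    push_cast
    linarith
  rw [stageTol, mul_pow, mul_assoc]
  exact le_mul_of_one_le_right (sq_nonneg τ) this

/-- For large budgets, if all the empirical objectives used by the algorithm are good
approximations of `F`, then the last stage reaches its tolerance, and the error of the estimator is
bounded in terms of this tolerance and of the gradient of the last objective at `θ`. -/
theorem eventually_norm_estimator_sub_le {𝓩 : Type*} {f : Vec d → 𝓩 → ℝ} {θ₀ : Vec d}
    {J Ceval Cgrad : ℕ} {α' δ κ τ t : ℝ} (hC : Constants F θ R A₁ A c η t β k₀)
    (hCeval : 0 < Ceval) (hα' : α' ∈ Set.Ioc (0 : ℝ) 1) (hδ : δ ∈ Set.Ioo (0 : ℝ) 1)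
    (hκ : 0 < κ) (hτ : 0 < τ) (hJ : 1 ≤ J)
    (hlevel : ∀ x, F x ≤ F θ₀ + 2 * J * η → x ∈ Metric.closedBall θ R) :
    ∀ᶠ B : ℕ in atTop, ∀ z : ℕ → 𝓩,
      (∀ j ∈ Finset.Icc 1 J, GoodApprox F (empRisk f z (stageSize κ δ B j)) θ R A₁ A η) →
      c / 2 * ‖estimator Ceval Cgrad f z θ₀ B α' δ J κ τ β - θ‖ ≤
        stageTol α' τ δ B J + ‖gradient (empRisk f z (stageSize κ δ B J)) θ‖ := by
  have hc := hC.c_pos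
  have hv : 0 < β ^ k₀ := pow_pos hC.β_mem.1 k₀
  have hb : 0 < β ^ k₀ * (c / 2) := by positivity
  filter_upwards [eventually_exists_number_of_steps hb
    (show 0 < β ^ k₀ * (c / 2) * τ ^ 2 by positivity) hκ hδ A₁ J Ceval Cgrad k₀,
    eventually_ge_atTop 1] with B hB hB1 z hgood
  obtain ⟨N, W, hN, hW, hJW⟩ := hB
  have hB0 : (0 : ℝ) < B := by exact_mod_cast hB1
  have hq : 0 ≤ 1 - β ^ k₀ * (c / 2) := by linarith [hC.pow_mul_c]
  have hqN : (1 - β ^ k₀ * (c / 2)) ^ N ≤ Real.exp (-(β ^ k₀ * (c / 2)) * N) := by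
    rw [mul_comm _ (N : ℝ), Real.exp_nat_mul]
    exact pow_le_pow_left₀ hq (Real.one_sub_le_exp_neg _) N
  obtain ⟨h1, -, -, h4⟩ := multiStage_spec (Cgrad := Cgrad) (W := W) (N := N) (τ := τ) (α' := α')
    hC hCeval hlevel hgood
    (fun j _ => Nat.ceil_pos.2 (mul_pos hκ (Real.rpow_pos_of_pos hB0 _)))
    (fun j _ => mul_pos hτ (Real.rpow_pos_of_pos hB0 _))
    (fun j _ => by
      refine le_of_mul_le_mul_right ?_ hB0
      calc _ ≤ Real.exp (-(β ^ k₀ * (c / 2)) * N) * A₁ ^ 2 * B := by gcongr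
        _ ≤ _ := hN
        _ ≤ β ^ k₀ * (c / 2) * (stageTol α' τ δ B j ^ 2 * B) :=
          mul_le_mul_of_nonneg_left (le_stageTol_sq hα' hδ hB1 j) hb.le
        _ = _ := by ring)
    hW hJW J le_rfl
  have hg := hgood J (Finset.mem_Icc.2 ⟨hJ, le_rfl⟩)
  exact ((hg.hessGEOn hC).norm_sub_le hg.contDiff hC.R_nonneg h1).trans
    (add_le_add_left (h4 hJ) _)

theorem tendsto_stageSize {κ δ : ℝ} (hκ : 0 < κ) (hδ : δ ∈ Set.Ioo (0 : ℝ) 1) {j : ℕ}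
    (hj : 1 ≤ j) : Tendsto (fun B => stageSize κ δ B j) atTop atTop :=
  tendsto_nat_ceil_atTop.comp ((tendsto_natCast_rpow
    (sub_pos.2 (pow_lt_one₀ hδ.1.le hδ.2 (by omega)))).const_mul_atTop hκ)

theorem tendsto_stageTol {α' τ δ : ℝ} (hα' : 0 < α') (hδ : δ ∈ Set.Ioo (0 : ℝ) 1) {j : ℕ}
    (hj : 1 ≤ j) : Tendsto (fun B => stageTol α' τ δ B j) atTop (𝓝 0) := by
  have hγ : 0 < 1 - δ ^ j := sub_pos.2 (pow_lt_one₀ hδ.1.le hδ.2 (by omega))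
  have := ((tendsto_rpow_neg_atTop (show 0 < α' / (1 + α') * (1 - δ ^ j) by positivity)).comp
    tendsto_natCast_atTop_atTop).const_mul τ
  rwa [mul_zero] at this

/-! ### Sublevel sets -/

/-- Strong convexity on the unit ball forces `F` to exceed its minimum by `c / 4` on the unit
sphere; convexity along rays turns this into linear growth, whatever the constants on larger sets.
-/
theorem LocallyStronglyConvex.exists_sublevel_subset (hF : LocallyStronglyConvex F)
    (hmin : ∀ x, F θ ≤ F x) (ℓ : ℝ) :
    ∃ R, 0 ≤ R ∧ ∀ x, F x ≤ ℓ → x ∈ Metric.closedBall θ R := by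
  obtain ⟨c, hc, hball⟩ := hF _ (isCompact_closedBall θ 1)
  have hgrow : ∀ x, 1 ≤ ‖x - θ‖ → c / 4 * ‖x - θ‖ ≤ F x - F θ := by
    intro x hx
    set r := ‖x - θ‖ with hr
    have hr0 : 0 < r := by linarith
    have hrinv : r⁻¹ ∈ Set.Icc (0 : ℝ) 1 := ⟨(inv_pos.2 hr0).le, inv_le_one_of_one_le₀ hx⟩
    set p := r⁻¹ • x + (1 - r⁻¹) • θ with hp
    have hpθ : ‖p - θ‖ = 1 := by
      rw [show p - θ = r⁻¹ • (x - θ) by rw [hp]; module, norm_smul, norm_inv, ← hr,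
        Real.norm_of_nonneg hr0.le, inv_mul_cancel₀ hr0.ne']
    have h1 := hball (1 / 2) ⟨by norm_num, by norm_num⟩ p
      (by rw [mem_closedBall_iff_norm, hpθ]) θ (Metric.mem_closedBall_self zero_le_one)
    have h2 := hmin ((1 / 2 : ℝ) • p + (1 - 1 / 2 : ℝ) • θ)
    rw [hpθ] at h1
    -- Only the endpoints must lie in the compact set, so two points suffice; the constant `c'`
    -- depends on `x` and is discarded.
    obtain ⟨c', hc', hseg⟩ := hF {x, θ} (Set.Finite.isCompact (by simp))
    have h3 := hseg r⁻¹ hrinv x (by simp) θ (by simp)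
    have h4 : 0 ≤ c' / 2 * (r⁻¹ * (1 - r⁻¹)) * ‖x - θ‖ ^ 2 := by
      have := hrinv.1
      have := sub_nonneg.2 hrinv.2
      positivity
    have h5 : c / 4 ≤ r⁻¹ * (F x - F θ) := by linarith
    calc c / 4 * r ≤ r⁻¹ * (F x - F θ) * r := by gcongr
      _ = F x - F θ := by field_simp
  refine ⟨max 1 ((ℓ - F θ) * 4 / c), le_max_of_le_left zero_le_one, fun x hx => ?_⟩
  rw [mem_closedBall_iff_norm, le_max_iff]
  by_cases h : ‖x - θ‖ ≤ 1
  · exact Or.inl h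
  · right
    have := hgrow x (not_le.1 h).le
    rw [le_div_iff₀ hc]
    linarith

end NoisyOpt

namespace NoisyOpt

/-! ### Measurability of derivatives with respect to a parameter -/

/-- Directional derivatives are limits of difference quotients with steps `1 / n`, and the
derivative is a finite linear combination of its values on a basis. -/
theorem measurable_fderiv_of_measurable_param {d : ℕ} {𝓩 E : Type*} [MeasurableSpace 𝓩]
    [NormedAddCommGroup E] [NormedSpace ℝ E] [FiniteDimensional ℝ E] [MeasurableSpace E]
    [BorelSpace E] {g : Vec d → 𝓩 → E} (hg : ∀ θ, Measurable (g θ))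
    (hd : ∀ z, Differentiable ℝ fun θ => g θ z) (θ : Vec d) :
    Measurable fun z => fderiv ℝ (fun θ' => g θ' z) θ := by
  have hdir : ∀ v : Vec d, Measurable fun z => fderiv ℝ (fun θ' => g θ' z) θ v := by
    intro v
    refine measurable_of_tendsto_metrizable (f := fun (n : ℕ) z =>
      (n : ℝ) • (g (θ + (n : ℝ)⁻¹ • v) z - g θ z))
      (fun n => ((hg _).sub (hg θ)).const_smul (n : ℝ)) (tendsto_pi_nhds.2 fun z => ?_)
    refine (hd z θ).hasFDerivAt.lim v ?_
    simpa using tendsto_natCast_atTop_atTop (R := ℝ)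
  let b := EuclideanSpace.basisFun (Fin d) ℝ
  have hsum : ∀ D : Vec d →L[ℝ] E, D = ∑ i, ContinuousLinearMap.smulRightL ℝ (Vec d) E
      (EuclideanSpace.proj i) (D (b i)) := by
    intro D
    ext v
    conv_lhs => rw [← b.sum_repr v, map_sum]
    simp [b]
  have : ProperSpace (Vec d →L[ℝ] E) := FiniteDimensional.proper ℝ _
  have : (fun z => fderiv ℝ (fun θ' => g θ' z) θ) = fun z =>
      ∑ i, ContinuousLinearMap.smulRightL ℝ (Vec d) E (EuclideanSpace.proj i)
        (fderiv ℝ (fun θ' => g θ' z) θ (b i)) := by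
    ext1 z
    exact hsum _
  rw [this]
  exact Finset.measurable_sum _ fun i _ =>
    (ContinuousLinearMap.continuous _).measurable.comp (hdir (b i))

variable {d : ℕ} {𝓩 : Type*} {f : Vec d → 𝓩 → ℝ}

theorem measurable_gradF [MeasurableSpace 𝓩] (hf : ∀ θ, Measurable (f θ))
    (hd : ∀ z, ContDiff ℝ 2 fun θ => f θ z) (θ : Vec d) : Measurable (gradF f θ) :=
  (InnerProductSpace.toDual ℝ (Vec d)).symm.continuous.measurable.comp
    (measurable_fderiv_of_measurable_param hf (fun z => (hd z).differentiable (by norm_num)) θ)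

theorem measurable_hessF [MeasurableSpace 𝓩] (hf : ∀ θ, Measurable (f θ))
    (hd : ∀ z, ContDiff ℝ 2 fun θ => f θ z) (θ : Vec d) : Measurable (hessF f θ) :=
  measurable_fderiv_of_measurable_param (measurable_gradF hf hd)
    (fun z => (contDiff_gradient (hd z)).differentiable (by norm_num)) θ

theorem continuous_hessF (hd : ∀ z, ContDiff ℝ 2 fun θ => f θ z) (z : 𝓩) :
    Continuous fun θ => hessF f θ z :=
  (contDiff_gradient (hd z)).continuous_fderiv (by norm_num)

/-- Continuity of the Hessian reduces the condition to a countable dense subset of `Θ`.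
Measurability is what lets an almost sure property of `Z` pass to its copies. -/
theorem measurableSet_lipschitz_hess [MeasurableSpace 𝓩] (hf : ∀ θ, Measurable (f θ))
    (hd : ∀ z, ContDiff ℝ 2 fun θ => f θ z) {M : 𝓩 → ℝ} (hM : Measurable M) (Θ : Set (Vec d)) :
    MeasurableSet {z | ∀ θ ∈ Θ, ∀ θ' ∈ Θ, ‖hessF f θ z - hessF f θ' z‖ ≤ M z * ‖θ - θ'‖} := by
  rcases Set.eq_empty_or_nonempty Θ with rfl | hne
  · simp
  have : Nonempty Θ := hne.to_subtype
  let q := TopologicalSpace.denseSeq Θ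
  have hset : {z | ∀ θ ∈ Θ, ∀ θ' ∈ Θ, ‖hessF f θ z - hessF f θ' z‖ ≤ M z * ‖θ - θ'‖} =
      ⋂ m, ⋂ n, {z | ‖hessF f (q m) z - hessF f (q n) z‖ ≤ M z * ‖(q m : Vec d) - q n‖} := by
    ext z
    simp only [Set.mem_ofPred_eq, Set.mem_iInter]
    refine ⟨fun h m n => h _ (q m).2 _ (q n).2, fun h θ hθ θ' hθ' => ?_⟩
    have hcont := continuous_hessF hd z
    refine (TopologicalSpace.denseRange_denseSeq Θ).induction_on₂
      (p := fun a b : Θ => ‖hessF f a z - hessF f b z‖ ≤ M z * ‖(a : Vec d) - b‖)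
      ?_ h ⟨θ, hθ⟩ ⟨θ', hθ'⟩
    exact isClosed_le (by fun_prop) (by fun_prop)
  have : ProperSpace (Vec d →L[ℝ] Vec d) := FiniteDimensional.proper ℝ _
  rw [hset]
  exact MeasurableSet.iInter fun m => MeasurableSet.iInter fun n => measurableSet_le
    ((measurable_hessF hf hd _).sub (measurable_hessF hf hd _)).norm (hM.mul_const _)

/-! ### The empirical risk -/

theorem contDiff_empRisk (hd : ∀ z, ContDiff ℝ 2 fun θ => f θ z) (z : ℕ → 𝓩) (n : ℕ) :
    ContDiff ℝ 2 (empRisk f z n) :=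
  contDiff_const.mul (ContDiff.sum fun i _ => hd (z i))

theorem gradient_empRisk (hd : ∀ z, ContDiff ℝ 2 fun θ => f θ z) (z : ℕ → 𝓩) (n : ℕ) :
    gradient (empRisk f z n) =
      fun θ => (n : ℝ)⁻¹ • ∑ i ∈ Finset.range n, gradF f θ (z i) := by
  ext1 θ
  have hdiff : ∀ i ∈ Finset.range n, DifferentiableAt ℝ (fun θ => f θ (z i)) θ := fun i _ =>
    (hd (z i)).differentiable (by norm_num) θ
  have hfd : fderiv ℝ (empRisk f z n) θ =
      (n : ℝ)⁻¹ • ∑ i ∈ Finset.range n, fderiv ℝ (fun θ => f θ (z i)) θ := by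
    unfold empRisk
    rw [fderiv_const_mul (DifferentiableAt.fun_sum hdiff), fderiv_fun_sum hdiff]
  simp only [gradF, gradient, hfd, map_smul, map_sum]

theorem fderiv_gradient_empRisk (hd : ∀ z, ContDiff ℝ 2 fun θ => f θ z) (z : ℕ → 𝓩) (n : ℕ)
    (θ : Vec d) : fderiv ℝ (gradient (empRisk f z n)) θ =
      (n : ℝ)⁻¹ • ∑ i ∈ Finset.range n, hessF f θ (z i) := by
  have hdiff : ∀ i ∈ Finset.range n, DifferentiableAt ℝ (fun θ => gradF f θ (z i)) θ :=
    fun i _ => (contDiff_gradient (hd (z i))).differentiable (by norm_num) θ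
  rw [gradient_empRisk hd, fderiv_fun_const_smul (DifferentiableAt.fun_sum hdiff),
    fderiv_fun_sum hdiff]
  rfl

theorem norm_average_le {E : Type*} [SeminormedAddCommGroup E] [NormedSpace ℝ E] {x : ℕ → E}
    {y : ℕ → ℝ} {n : ℕ} (h : ∀ i ∈ Finset.range n, ‖x i‖ ≤ y i) :
    ‖(n : ℝ)⁻¹ • ∑ i ∈ Finset.range n, x i‖ ≤ (n : ℝ)⁻¹ * ∑ i ∈ Finset.range n, y i := by
  rw [norm_smul, norm_inv, Real.norm_natCast]
  exact mul_le_mul_of_nonneg_left (norm_sum_le_of_le _ h) (by positivity)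

/-- This reduces uniform control of the derivatives to a law of large numbers for the scalar `Λ`. -/
theorem envelopedBy_empRisk (hd : ∀ z, ContDiff ℝ 2 fun θ => f θ z) {z : ℕ → 𝓩} {θ : Vec d}
    {ρ : ℝ} {Λ : 𝓩 → ℝ} (h : ∀ i, EnvelopedBy (fun θ' => f θ' (z i)) θ ρ (Λ (z i))) (n : ℕ) :
    EnvelopedBy (empRisk f z n) θ ρ ((n : ℝ)⁻¹ * ∑ i ∈ Finset.range n, Λ (z i)) := by
  intro x hx
  refine ⟨?_, ?_, fun y hy => ?_⟩
  · rw [gradient_empRisk hd]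
    exact norm_average_le fun i _ => (h i x hx).1
  · rw [fderiv_gradient_empRisk hd]
    exact norm_average_le fun i _ => (h i x hx).2.1
  · have hsub : fderiv ℝ (gradient (empRisk f z n)) x - fderiv ℝ (gradient (empRisk f z n)) y =
        (n : ℝ)⁻¹ • ∑ i ∈ Finset.range n, (hessF f x (z i) - hessF f y (z i)) := by
      rw [fderiv_gradient_empRisk hd, fderiv_gradient_empRisk hd, Finset.sum_sub_distrib]
      exact (smul_sub _ _ _).symm
    rw [hsub, mul_assoc, Finset.sum_mul]
    exact norm_average_le fun i _ => (h i x hx).2.2 y hy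

/-! ### An integrable envelope for the derivatives -/

/-- The Lipschitz bound is propagated from the centre to the Hessian, then to the gradient. Factors
`1 + ρ` instead of `ρ` let one constant dominate all three quantities. -/
theorem envelopedBy_of_lipschitz {g : Vec d → ℝ} (hg : ContDiff ℝ 2 g) {θ : Vec d} {ρ M : ℝ}
    (hρ : 0 ≤ ρ) (hM : 0 ≤ M)
    (hlip : ∀ x ∈ Metric.closedBall θ ρ, ∀ y ∈ Metric.closedBall θ ρ,
      ‖fderiv ℝ (gradient g) x - fderiv ℝ (gradient g) y‖ ≤ M * ‖x - y‖) :
    EnvelopedBy g θ ρ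
      (‖gradient g θ‖ + (1 + ρ) * (‖fderiv ℝ (gradient g) θ‖ + (1 + ρ) * M)) := by
  have hθ : θ ∈ Metric.closedBall θ ρ := Metric.mem_closedBall_self hρ
  set h₀ := ‖fderiv ℝ (gradient g) θ‖ with hh₀
  have h₀0 : 0 ≤ h₀ := norm_nonneg _
  have hhess : ∀ x ∈ Metric.closedBall θ ρ, ‖fderiv ℝ (gradient g) x‖ ≤ h₀ + (1 + ρ) * M := by
    intro x hx
    have h1 := hlip x hx θ hθ
    have h2 := norm_le_norm_add_norm_sub' (fderiv ℝ (gradient g) x) (fderiv ℝ (gradient g) θ)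
    rw [mem_closedBall_iff_norm] at hx
    nlinarith
  have hnn : 0 ≤ h₀ + (1 + ρ) * M := by positivity
  intro x hx
  refine ⟨?_, ?_, fun y hy => (hlip x hx y hy).trans ?_⟩
  · have h1 := Convex.norm_image_sub_le_of_norm_fderiv_le (𝕜 := ℝ) (f := gradient g)
      (fun z _ => (contDiff_gradient hg).differentiable (by norm_num) z) hhess
      (convex_closedBall θ ρ) hθ hx
    have h2 := norm_le_norm_add_norm_sub' (gradient g x) (gradient g θ)
    rw [mem_closedBall_iff_norm] at hx
    nlinarith
  · have := hhess x hx
    have := norm_nonneg (gradient g θ)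
    nlinarith
  · apply mul_le_mul_of_nonneg_right _ (norm_nonneg _)
    have := norm_nonneg (gradient g θ)
    nlinarith [mul_nonneg hρ hM, mul_nonneg hρ h₀0, mul_nonneg hρ (mul_nonneg hρ hM)]

theorem SmoothMoment.integrable_norm_gradF {Ω : Type*} [MeasurableSpace Ω] {P : Measure Ω}
    [IsProbabilityMeasure P] [MeasurableSpace 𝓩] {Z : Ω → 𝓩} (hZ : Measurable Z)
    (hf : ∀ θ, Measurable (f θ)) {θ : Vec d} {α : ℝ} (hα : 0 < α)
    (h : SmoothMoment P f Z θ α) : Integrable (fun ω => ‖gradF f θ (Z ω)‖) P := by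
  refine Integrable.mono' ((integrable_const (1 : ℝ)).add h.integrable_grad)
    ((measurable_gradF hf h.contDiff θ).comp hZ).norm.aestronglyMeasurable
    (Eventually.of_forall fun ω => ?_)
  rw [norm_norm]
  show _ ≤ 1 + ‖gradF f θ (Z ω)‖ ^ (1 + α)
  rcases le_total ‖gradF f θ (Z ω)‖ 1 with h1 | h1
  · have := Real.rpow_nonneg (norm_nonneg (gradF f θ (Z ω))) (1 + α)
    linarith
  · have := Real.self_le_rpow_of_one_le h1 (by linarith : 1 ≤ 1 + α)
    linarith

/-- `Λ` is an integrable function which controls the derivatives of `θ' ↦ f θ' z` on the ball of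
radius `ρ` around `θ`, for almost all `z`. -/
structure IsEnvelope {Ω : Type*} [MeasurableSpace Ω] [MeasurableSpace 𝓩] (P : Measure Ω)
    (f : Vec d → 𝓩 → ℝ) (Z : Ω → 𝓩) (θ : Vec d) (ρ : ℝ) (Λ : 𝓩 → ℝ) : Prop where
  measurable : Measurable Λ
  nonneg : ∀ z, 0 ≤ Λ z
  integrable : Integrable (fun ω => Λ (Z ω)) P
  exists_measurableSet : ∃ T, MeasurableSet T ∧ (∀ᵐ ω ∂P, Z ω ∈ T) ∧
    ∀ z ∈ T, EnvelopedBy (fun θ' => f θ' z) θ ρ (Λ z)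

variable {Ω : Type*} [MeasurableSpace Ω] {P : Measure Ω} [MeasurableSpace 𝓩] {Z : Ω → 𝓩}
  {θ : Vec d} {ρ : ℝ} {Λ : 𝓩 → ℝ}

theorem SmoothMoment.exists_isEnvelope [IsProbabilityMeasure P] (hZ : Measurable Z)
    (hf : ∀ θ, Measurable (f θ)) {α : ℝ} (hα : 0 < α) (h : SmoothMoment P f Z θ α)
    (hρ : 0 ≤ ρ) : ∃ Λ, IsEnvelope P f Z θ ρ Λ := by
  obtain ⟨M, hM, hM0, hMint, hMlip⟩ := h.lipschitz_hess _ (isCompact_closedBall θ ρ)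
  refine ⟨fun z => ‖gradF f θ z‖ + (1 + ρ) * (‖hessF f θ z‖ + (1 + ρ) * M z), ?_, ?_, ?_,
    _, measurableSet_lipschitz_hess hf h.contDiff hM _, hMlip, fun z hz =>
      envelopedBy_of_lipschitz (h.contDiff z) hρ (hM0 z) hz⟩
  · exact (measurable_gradF hf h.contDiff θ).norm.add
      (((measurable_hessF hf h.contDiff θ).norm.add (hM.const_mul _)).const_mul _)
  · intro z
    have := hM0 z
    positivity
  · exact (h.integrable_norm_gradF hZ hf hα).add
      ((h.integrable_hess.add (hMint.const_mul _)).const_mul _)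

theorem IsEnvelope.ae_envelopedBy (h : IsEnvelope P f Z θ ρ Λ) :
    ∀ᵐ ω ∂P, EnvelopedBy (fun θ' => f θ' (Z ω)) θ ρ (Λ (Z ω)) := by
  obtain ⟨T, -, hT, henv⟩ := h.exists_measurableSet
  filter_upwards [hT] with ω hω using henv _ hω

theorem IsEnvelope.ae_forall_envelopedBy (h : IsEnvelope P f Z θ ρ Λ) {Zs : ℕ → Ω → 𝓩}
    (hident : ∀ i, IdentDistrib (Zs i) Z P P) :
    ∀ᵐ ω ∂P, ∀ i, EnvelopedBy (fun θ' => f θ' (Zs i ω)) θ ρ (Λ (Zs i ω)) := by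
  obtain ⟨T, hTm, hT, henv⟩ := h.exists_measurableSet
  refine ae_all_iff.2 fun i => ?_
  filter_upwards [(hident i).symm.ae_snd (p := (· ∈ T)) hTm hT] with ω hω using henv _ hω

theorem IsEnvelope.abs_risk_sub_le (h : IsEnvelope P f Z θ ρ Λ)
    (hd : ∀ z, ContDiff ℝ 2 fun θ => f θ z) (hint : ∀ θ, Integrable (fun ω => f θ (Z ω)) P)
    {x y : Vec d} (hx : x ∈ Metric.closedBall θ ρ) (hy : y ∈ Metric.closedBall θ ρ) :
    |risk P f Z x - risk P f Z y| ≤ (∫ ω, Λ (Z ω) ∂P) * ‖x - y‖ := by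
  rw [risk, risk, ← integral_sub (hint x) (hint y), ← integral_mul_const]
  refine abs_integral_le_integral_abs.trans (integral_mono_ae ((hint x).sub (hint y)).abs
    (h.integrable.mul_const _) ?_)
  filter_upwards [h.ae_envelopedBy] with ω hω using hω.abs_sub_le (hd _) hx hy

/-- The gradient of `f` at a minimiser of the risk is centred. -/
theorem IsEnvelope.integral_fderiv_eq_zero (h : IsEnvelope P f Z θ ρ Λ) (hρ : 0 < ρ)
    (hZ : Measurable Z) (hf : ∀ θ, Measurable (f θ)) (hd : ∀ z, ContDiff ℝ 2 fun θ => f θ z)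
    (hint : ∀ θ, Integrable (fun ω => f θ (Z ω)) P)
    (hmin : ∀ x, risk P f Z θ ≤ risk P f Z x) :
    Integrable (fun ω => fderiv ℝ (fun θ' => f θ' (Z ω)) θ) P ∧
      ∫ ω, fderiv ℝ (fun θ' => f θ' (Z ω)) θ ∂P = 0 := by
  have hd1 : ∀ z, Differentiable ℝ fun θ => f θ z := fun z => (hd z).differentiable (by norm_num)
  have : ProperSpace (Vec d →L[ℝ] ℝ) := FiniteDimensional.proper ℝ _
  obtain ⟨h1, h2⟩ := hasFDerivAt_integral_of_dominated_loc_of_lip (𝕜 := ℝ) (μ := P)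
    (F := fun θ ω => f θ (Z ω)) (F' := fun ω => fderiv ℝ (fun θ' => f θ' (Z ω)) θ)
    (bound := fun ω => Λ (Z ω)) (Metric.closedBall_mem_nhds θ hρ)
    (Eventually.of_forall fun x => ((hf x).comp hZ).aestronglyMeasurable) (hint θ)
    ((measurable_fderiv_of_measurable_param hf hd1 θ).comp hZ).aestronglyMeasurable
    (by
      filter_upwards [h.ae_envelopedBy] with ω hω
      refine LipschitzOnWith.of_dist_le_mul fun x hx y hy => ?_
      rw [Real.dist_eq, dist_eq_norm, Real.coe_nnabs, abs_of_nonneg (h.nonneg _)]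
      exact hω.abs_sub_le (hd _) hx hy)
    h.integrable (Eventually.of_forall fun ω => (hd1 (Z ω) θ).hasFDerivAt)
  refine ⟨h1, ?_⟩
  have hloc : IsLocalMin (fun x => ∫ ω, f x (Z ω) ∂P) θ := Eventually.of_forall hmin
  rw [← h2.fderiv, hloc.fderiv_eq_zero]

end NoisyOpt

namespace NoisyOpt

/-! ### Weak laws of large numbers -/

theorem tendsto_measure_average_sub_ge {Ω 𝓩 : Type*} [MeasurableSpace Ω] {P : Measure Ω}
    [IsProbabilityMeasure P] [MeasurableSpace 𝓩] {Z : Ω → 𝓩} {Zs : ℕ → Ω → 𝓩}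
    (hZs : ∀ i, Measurable (Zs i)) (hindep : iIndepFun Zs P)
    (hident : ∀ i, IdentDistrib (Zs i) Z P P) {h : 𝓩 → ℝ} (hh : Measurable h)
    (hint : Integrable (fun ω => h (Z ω)) P) {ε : ℝ} (hε : 0 < ε) :
    Tendsto (fun n : ℕ => P {ω | ε ≤
      |(n : ℝ)⁻¹ * ∑ i ∈ Finset.range n, h (Zs i ω) - ∫ ω', h (Z ω') ∂P|}) atTop (𝓝 0) := by
  have hid : ∀ i, IdentDistrib (fun ω => h (Zs i ω)) (fun ω => h (Z ω)) P P :=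
    fun i => (hident i).comp hh
  have hlln := strong_law_ae (μ := P) (fun i ω => h (Zs i ω)) ((hid 0).integrable_iff.2 hint)
    (fun i j hij => (hindep.indepFun hij).comp hh hh) (fun i => (hid i).trans (hid 0).symm)
  rw [(hid 0).integral_eq] at hlln
  have hmeas : ∀ n : ℕ, AEStronglyMeasurable
      (fun ω => (n : ℝ)⁻¹ • ∑ i ∈ Finset.range n, h (Zs i ω)) P := fun n =>
    ((Finset.measurable_sum _ fun i _ => hh.comp (hZs i)).const_smul
      (n : ℝ)⁻¹).aestronglyMeasurable
  exact tendstoInMeasure_iff_norm.1 (tendstoInMeasure_of_tendsto_ae hmeas hlln) ε hε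

/-- A sum of `n` i.i.d. centred variables with finite moment of order `p ∈ [1, 2]` is
`O_ℙ(n^{1/p})`: the case of one truncation level. -/
theorem measure_sum_ge_le {Ω : Type*} [MeasurableSpace Ω] {P : Measure Ω}
    [IsProbabilityMeasure P] {X : ℕ → Ω → ℝ} (hX : ∀ i, Measurable (X i)) (hindep : iIndepFun X P)
    (hident : ∀ i, IdentDistrib (X i) (X 0) P P) {p : ℝ} (hp : p ∈ Set.Icc (1 : ℝ) 2)
    (hint : Integrable (fun ω => |X 0 ω| ^ p) P) (hint1 : Integrable (X 0) P)
    (hmean : ∫ ω, X 0 ω ∂P = 0) {n : ℕ} {T s : ℝ} (hT : 0 < T) (hs : 0 < s) :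
    P {ω | s + n * (T ^ (1 - p) * ∫ ω, |X 0 ω| ^ p ∂P) ≤ |∑ i ∈ Finset.range n, X i ω|} ≤
      ENNReal.ofReal (n * ((∫ ω, |X 0 ω| ^ p ∂P) / T ^ p)) +
        ENNReal.ofReal (n * (T ^ (2 - p) * ∫ ω, |X 0 ω| ^ p ∂P) / s ^ 2) := by
  set m := ∫ ω, |X 0 ω| ^ p ∂P with hm
  have hm0 : 0 ≤ m := integral_nonneg fun ω => Real.rpow_nonneg (abs_nonneg _) p
  have hp0 : 0 < p := by linarith [hp.1]
  -- Truncation to zero beyond level `T`. `hτ_sq` will bound the variance of the truncated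
  -- variables, `hτ_sub` the mean they acquire.
  let τ : ℝ → ℝ := (Set.Icc (-T) T).indicator id
  have hτm : Measurable τ := measurable_id.indicator measurableSet_Icc
  have hτ_of_le : ∀ x, |x| ≤ T → τ x = x := fun x hx =>
    Set.indicator_of_mem (Set.mem_Icc.2 (abs_le.1 hx)) _
  have hτ_of_lt : ∀ x, T < |x| → τ x = 0 := fun x hx =>
    Set.indicator_of_notMem (fun h => absurd (abs_le.2 (Set.mem_Icc.1 h)) (not_le.2 hx)) _
  have hτT : ∀ x, |τ x| ≤ T := fun x => by
    rcases le_or_gt |x| T with h | h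
    · rwa [hτ_of_le x h]
    · rw [hτ_of_lt x h, abs_zero]; exact hT.le
  have hτ_sq : ∀ x, τ x ^ 2 ≤ T ^ (2 - p) * |x| ^ p := fun x => by
    rcases le_or_gt |x| T with h | h
    · rw [hτ_of_le x h, ← sq_abs, ← Real.rpow_natCast]
      rcases (abs_nonneg x).eq_or_lt with h0 | h0
      · rw [← h0, Real.zero_rpow hp0.ne', Real.zero_rpow (by norm_num), mul_zero]
      · calc |x| ^ ((2 : ℕ) : ℝ) = |x| ^ (2 - p) * |x| ^ p := by
              rw [← Real.rpow_add h0]; norm_num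
          _ ≤ _ := by
              gcongr
              linarith [hp.2]
    · rw [hτ_of_lt x h, zero_pow two_ne_zero]
      have := Real.rpow_nonneg (abs_nonneg x) p
      positivity
  have hτ_sub : ∀ x, |x - τ x| ≤ T ^ (1 - p) * |x| ^ p := fun x => by
    rcases le_or_gt |x| T with h | h
    · rw [hτ_of_le x h, sub_self, abs_zero]
      have := Real.rpow_nonneg (abs_nonneg x) p
      positivity
    · rw [hτ_of_lt x h, sub_zero]
      have hx0 : 0 < |x| := hT.trans h
      calc |x| = |x| ^ (1 - p) * |x| ^ p := by
            rw [← Real.rpow_add hx0]; norm_num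
        _ ≤ _ := by
            gcongr ?_ * _
            exact Real.rpow_le_rpow_of_nonpos hT h.le (by linarith [hp.1])
  let Y : ℕ → Ω → ℝ := fun i ω => τ (X i ω)
  have hYm : ∀ i, Measurable (Y i) := fun i => hτm.comp (hX i)
  have hYid : ∀ i, IdentDistrib (Y i) (Y 0) P P := fun i => (hident i).comp hτm
  have hY2 : ∀ i, MemLp (Y i) 2 P := fun i =>
    MemLp.of_bound (hYm i).aestronglyMeasurable T (Eventually.of_forall fun ω => hτT _)
  have hY1 : ∀ i, Integrable (Y i) P := fun i => (hY2 i).integrable (by norm_num)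
  have hYmean : |∫ ω, Y 0 ω ∂P| ≤ T ^ (1 - p) * m := by
    have : ∫ ω, Y 0 ω ∂P = -∫ ω, (X 0 ω - Y 0 ω) ∂P := by
      rw [integral_sub hint1 (hY1 0), hmean]; ring
    rw [this, abs_neg]
    refine (abs_integral_le_integral_abs).trans ?_
    rw [hm, ← integral_const_mul]
    exact integral_mono (hint1.sub (hY1 0)).abs (hint.const_mul _) fun ω => hτ_sub _
  have hvar : Var[Y 0; P] ≤ T ^ (2 - p) * m := by
    refine (variance_le_expectation_sq (hYm 0).aestronglyMeasurable).trans ?_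
    rw [hm, ← integral_const_mul]
    exact integral_mono (hY2 0).integrable_sq (hint.const_mul _) fun ω => hτ_sq _
  have hvarsum : Var[∑ i ∈ Finset.range n, Y i; P] ≤ n * (T ^ (2 - p) * m) := by
    rw [IndepFun.variance_sum (fun i _ => hY2 i)
      (fun i _ j _ hij => (hindep.indepFun hij).comp hτm hτm)]
    simp only [(hYid _).variance_eq, Finset.sum_const, Finset.card_range, nsmul_eq_mul]
    gcongr
  have hsummean : |∫ ω, (∑ i ∈ Finset.range n, Y i) ω ∂P| ≤ n * (T ^ (1 - p) * m) := by
    simp only [Finset.sum_apply]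
    rw [integral_finsetSum _ fun i _ => hY1 i]
    simp only [(hYid _).integral_eq, Finset.sum_const, Finset.card_range, nsmul_eq_mul, abs_mul,
      Nat.abs_cast]
    gcongr
  have hcheb := meas_ge_le_variance_div_sq
    (memLp_finsetSum' (Finset.range n) fun i _ => hY2 i) hs
  have htail : ∀ i, P {ω | T < |X i ω|} ≤ ENNReal.ofReal (m / T ^ p) := by
    intro i
    have hTp : 0 < T ^ p := Real.rpow_pos_of_pos hT p
    have hev : P {ω | T < |X i ω|} = P {ω | T < |X 0 ω|} :=
      (hident i).measure_mem_eq (s := {x : ℝ | T < |x|})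
        (measurableSet_lt measurable_const measurable_id.abs)
    rw [hev, ← ofReal_measureReal]
    apply ENNReal.ofReal_le_ofReal
    rw [le_div_iff₀ hTp, mul_comm]
    refine le_trans ?_ (mul_meas_ge_le_integral_of_nonneg
      (Eventually.of_forall fun ω => Real.rpow_nonneg (abs_nonneg (X 0 ω)) p) hint (T ^ p))
    refine mul_le_mul_of_nonneg_left (measureReal_mono fun ω hω => ?_) hTp.le
    exact Real.rpow_le_rpow hT.le (le_of_lt hω) hp0.le
  -- Either some variable exceeds `T` (Markov), or the sum equals the truncated one, which must then
  -- deviate by `s` from its mean (Chebyshev).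
  have hsub : {ω | s + n * (T ^ (1 - p) * m) ≤ |∑ i ∈ Finset.range n, X i ω|} ⊆
      (⋃ i ∈ Finset.range n, {ω | T < |X i ω|}) ∪
        {ω | s ≤ |(∑ i ∈ Finset.range n, Y i) ω - ∫ ω', (∑ i ∈ Finset.range n, Y i) ω' ∂P|} := by
    intro ω hω
    by_cases hbig : ∃ i ∈ Finset.range n, T < |X i ω|
    · obtain ⟨i, hi, hiT⟩ := hbig
      exact Or.inl (Set.mem_biUnion hi hiT)
    · push Not at hbig
      right
      have hXY : ∑ i ∈ Finset.range n, X i ω = (∑ i ∈ Finset.range n, Y i) ω := by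
        rw [Finset.sum_apply]
        exact Finset.sum_congr rfl fun i hi => (hτ_of_le _ (hbig i hi)).symm
      rw [Set.mem_ofPred_eq, hXY] at hω
      have := abs_sub_abs_le_abs_sub ((∑ i ∈ Finset.range n, Y i) ω)
        (∫ ω', (∑ i ∈ Finset.range n, Y i) ω' ∂P)
      rw [Set.mem_ofPred_eq]
      linarith
  refine (measure_mono hsub).trans ((measure_union_le _ _).trans (add_le_add ?_ ?_))
  · refine (measure_biUnion_finset_le _ _).trans ((Finset.sum_le_sum fun i _ => htail i).trans ?_)
    rw [Finset.sum_const, Finset.card_range, nsmul_eq_mul, ENNReal.ofReal_mul (by positivity),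
      ENNReal.ofReal_natCast]
  · exact hcheb.trans (ENNReal.ofReal_le_ofReal (by gcongr))

/-- A sum of `n` i.i.d. centred variables with finite moment of order `p ∈ [1, 2]` is
`O_ℙ(n^{1/p})`. -/
theorem exists_measure_sum_ge_le {Ω : Type*} [MeasurableSpace Ω] {P : Measure Ω}
    [IsProbabilityMeasure P] {X : ℕ → Ω → ℝ} (hX : ∀ i, Measurable (X i)) (hindep : iIndepFun X P)
    (hident : ∀ i, IdentDistrib (X i) (X 0) P P) {p : ℝ} (hp : p ∈ Set.Icc (1 : ℝ) 2)
    (hint : Integrable (fun ω => |X 0 ω| ^ p) P) (hint1 : Integrable (X 0) P)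
    (hmean : ∫ ω, X 0 ω ∂P = 0) {ε : ℝ} (hε : 0 < ε) :
    ∃ M > 0, ∀ n : ℕ, 1 ≤ n →
      P {ω | M * (n : ℝ) ^ p⁻¹ ≤ |∑ i ∈ Finset.range n, X i ω|} ≤ ENNReal.ofReal ε := by
  set m := ∫ ω, |X 0 ω| ^ p ∂P with hm
  have hm0 : 0 ≤ m := integral_nonneg fun ω => Real.rpow_nonneg (abs_nonneg _) p
  have hp0 : 0 < p := by linarith [hp.1]
  -- With `T = lam * n ^ p⁻¹` and `s = σ * n ^ p⁻¹` both error terms are free of `n`; `lam` makes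
  -- the first at most `ε / 2`, `σ` the second. The `+ 1` avoids a zero constant.
  set lam : ℝ := (2 * (m + 1) / ε) ^ p⁻¹ with hlam
  have hlam0 : 0 < lam := by positivity
  have hlamp : lam ^ p = 2 * (m + 1) / ε := by
    rw [hlam, ← Real.rpow_mul (by positivity), inv_mul_cancel₀ hp0.ne', Real.rpow_one]
  set K : ℝ := lam ^ (2 - p) * m with hK
  have hK0 : 0 ≤ K := by positivity
  set σ : ℝ := √(2 * (K + 1) / ε) with hσ
  have hσ0 : 0 < σ := Real.sqrt_pos.2 (by positivity)
  have hσ2 : σ ^ 2 = 2 * (K + 1) / ε := Real.sq_sqrt (by positivity)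
  refine ⟨σ + lam ^ (1 - p) * m, by positivity, fun n hn => ?_⟩
  have hn0 : (0 : ℝ) < n := by exact_mod_cast hn
  set N : ℝ := (n : ℝ) ^ p⁻¹ with hN
  have hN0 : 0 < N := by positivity
  have hNp : N ^ p = n := by
    rw [hN, ← Real.rpow_mul hn0.le, inv_mul_cancel₀ hp0.ne', Real.rpow_one]
  have key := measure_sum_ge_le hX hindep hident hp hint hint1 hmean (n := n)
    (T := lam * N) (s := σ * N) (by positivity) (by positivity)
  rw [← hm] at key
  have e1 : (n : ℝ) * ((lam * N) ^ (1 - p) * m) = lam ^ (1 - p) * m * N := by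
    rw [Real.mul_rpow hlam0.le hN0.le, ← hNp]
    have : N ^ p * N ^ (1 - p) = N := by rw [← Real.rpow_add hN0]; norm_num
    linear_combination lam ^ (1 - p) * m * this
  have e2 : (n : ℝ) * (m / (lam * N) ^ p) ≤ ε / 2 := by
    rw [Real.mul_rpow hlam0.le hN0.le, hNp, hlamp]
    have : (n : ℝ) * (m / (2 * (m + 1) / ε * n)) = ε / 2 * (m / (m + 1)) := by
      field_simp
    rw [this]
    have : m / (m + 1) ≤ 1 := (div_le_one (by linarith)).2 (by linarith)
    nlinarith
  have e3 : (n : ℝ) * ((lam * N) ^ (2 - p) * m) / (σ * N) ^ 2 ≤ ε / 2 := by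
    have h1 : (n : ℝ) * ((lam * N) ^ (2 - p) * m) = K * N ^ 2 := by
      rw [Real.mul_rpow hlam0.le hN0.le, ← hNp, hK]
      have : N ^ p * N ^ (2 - p) = N ^ 2 := by
        rw [← Real.rpow_add hN0, ← Real.rpow_natCast]; norm_num
      linear_combination lam ^ (2 - p) * m * this
    rw [h1, mul_pow, mul_div_mul_right _ _ (by positivity), hσ2]
    have : K / (2 * (K + 1) / ε) = ε / 2 * (K / (K + 1)) := by field_simp
    rw [this]
    have : K / (K + 1) ≤ 1 := (div_le_one (by linarith)).2 (by linarith)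
    nlinarith
  rw [e1, ← add_mul] at key
  refine key.trans ((add_le_add (ENNReal.ofReal_le_ofReal e2)
    (ENNReal.ofReal_le_ofReal e3)).trans (le_of_eq ?_))
  rw [← ENNReal.ofReal_add (by positivity) (by positivity), add_halves]

end NoisyOpt

namespace NoisyOpt

/-! ### The gradient of the empirical risk at the minimiser -/

theorem norm_le_sum_abs {d : ℕ} (x : Vec d) : ‖x‖ ≤ ∑ k, |x k| := by
  conv_lhs => rw [← (EuclideanSpace.basisFun (Fin d) ℝ).sum_repr x]
  refine norm_sum_le_of_le _ fun k _ => ?_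
  rw [norm_smul]
  simp

variable {d : ℕ} {Ω 𝓩 : Type*} [MeasurableSpace Ω] {P : Measure Ω} [IsProbabilityMeasure P]
  [MeasurableSpace 𝓩] {f : Vec d → 𝓩 → ℝ} {Z : Ω → 𝓩} {Zs : ℕ → Ω → 𝓩} {θ : Vec d}

/-- The coordinates of the gradient are centred, as `θ` minimises the risk, so the bound for sums
applies to each with `p = 1 + α`; dividing by `n` gives the exponent. -/
theorem SmoothMoment.exists_measure_gradient_empRisk_ge_le {α : ℝ} (hα : α ∈ Set.Ioc (0 : ℝ) 1)
    (h : SmoothMoment P f Z θ α) (hf : ∀ θ, Measurable (f θ)) (hZ : Measurable Z)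
    (hZs : ∀ i, Measurable (Zs i)) (hindep : iIndepFun Zs P)
    (hident : ∀ i, IdentDistrib (Zs i) Z P P) (hint : ∀ θ, Integrable (fun ω => f θ (Z ω)) P)
    (hmin : ∀ x, risk P f Z θ ≤ risk P f Z x) {ε : ℝ} (hε : 0 < ε) :
    ∃ M > 0, ∀ n : ℕ, 1 ≤ n →
      P {ω | M * (n : ℝ) ^ (-(α / (1 + α))) ≤
        ‖gradient (empRisk f (fun i => Zs i ω) n) θ‖} ≤ ENNReal.ofReal ε := by
  obtain ⟨Λ, hΛ⟩ := h.exists_isEnvelope hZ hf hα.1 zero_le_one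
  obtain ⟨hfd1, hfd0⟩ := hΛ.integral_fderiv_eq_zero one_pos hZ hf h.contDiff hint hmin
  let e := EuclideanSpace.basisFun (Fin d) ℝ
  have hcoord : ∀ k z, (gradF f θ z) k = fderiv ℝ (fun θ' => f θ' z) θ (e k) := fun k z => by
    have hinner : ∀ x : Vec d, x k = inner ℝ x (e k) := fun x => by
      simp [e, EuclideanSpace.inner_single_right]
    rw [← inner_gradient_left]
    exact hinner _
  have hcm : ∀ k, Measurable fun z => (gradF f θ z) k := fun k =>
    (EuclideanSpace.proj (𝕜 := ℝ) k).continuous.measurable.comp (measurable_gradF hf h.contDiff θ)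
  have hcint : ∀ k, Integrable (fun ω => (gradF f θ (Z ω)) k) P := fun k => by
    simp only [hcoord]
    exact hfd1.apply_continuousLinearMap (e k)
  have hcmean : ∀ k, ∫ ω, (gradF f θ (Z ω)) k ∂P = 0 := fun k => by
    simp only [hcoord]
    rw [← ContinuousLinearMap.integral_apply hfd1, hfd0, zero_apply]
  have hcp : ∀ k, Integrable (fun ω => |(gradF f θ (Z ω)) k| ^ (1 + α)) P := fun k => by
    refine h.integrable_grad.mono'
      (((hcm k).comp hZ).abs.pow_const _).aestronglyMeasurable (Eventually.of_forall fun ω => ?_)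
    rw [Real.norm_of_nonneg (Real.rpow_nonneg (abs_nonneg _) _)]
    exact Real.rpow_le_rpow (abs_nonneg _) (PiLp.norm_apply_le (gradF f θ (Z ω)) k) (by linarith [hα.1])
  have hid : ∀ k i, IdentDistrib (fun ω => (gradF f θ (Zs i ω)) k)
      (fun ω => (gradF f θ (Z ω)) k) P P := fun k i => (hident i).comp (hcm k)
  have habs : Measurable fun x : ℝ => |x| ^ (1 + α) := measurable_id.abs.pow_const _
  have hcoordrate : ∀ k, ∃ M > 0, ∀ n : ℕ, 1 ≤ n →
      P {ω | M * (n : ℝ) ^ (1 + α)⁻¹ ≤ |∑ i ∈ Finset.range n, (gradF f θ (Zs i ω)) k|} ≤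
        -- Level for a union bound over `d` coordinates; `d + 1` keeps it meaningful for `d = 0`.
        ENNReal.ofReal (ε / (d + 1)) := fun k =>
    exists_measure_sum_ge_le (fun i => (hcm k).comp (hZs i))
      (hindep.comp (fun _ z => (gradF f θ z) k) fun _ => hcm k)
      (fun i => (hid k i).trans (hid k 0).symm) ⟨by linarith [hα.1], by linarith [hα.2]⟩
      (((hid k 0).comp habs).integrable_iff.2 (hcp k)) ((hid k 0).integrable_iff.2 (hcint k))
      ((hid k 0).integral_eq.trans (hcmean k)) (by positivity)
  choose M hM0 hM using hcoordrate
  have hMsum : 0 ≤ ∑ k, M k := Finset.sum_nonneg fun k _ => (hM0 k).le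
  refine ⟨∑ k, M k + 1, by linarith, fun n hn => ?_⟩
  have hn0 : (0 : ℝ) < n := by exact_mod_cast hn
  have hα0 := hα.1
  have hexp : (n : ℝ)⁻¹ * (n : ℝ) ^ (1 + α)⁻¹ = (n : ℝ) ^ (-(α / (1 + α))) := by
    rw [← Real.rpow_neg_one, ← Real.rpow_add hn0]
    congr 1
    field_simp
    ring
  have hrate : 0 < (n : ℝ) ^ (-(α / (1 + α))) := Real.rpow_pos_of_pos hn0 _
  have hsub : {ω | (∑ k, M k + 1) * (n : ℝ) ^ (-(α / (1 + α))) ≤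
      ‖gradient (empRisk f (fun i => Zs i ω) n) θ‖} ⊆
      ⋃ k ∈ (Finset.univ : Finset (Fin d)),
        {ω | M k * (n : ℝ) ^ (1 + α)⁻¹ ≤ |∑ i ∈ Finset.range n, (gradF f θ (Zs i ω)) k|} := by
    intro ω hω
    by_contra hnot
    simp only [Set.mem_iUnion, Set.mem_ofPred_eq, not_exists, not_le, Finset.mem_univ,
      exists_prop, true_and] at hnot
    rw [Set.mem_ofPred_eq, gradient_empRisk h.contDiff] at hω
    have hle : ‖(n : ℝ)⁻¹ • ∑ i ∈ Finset.range n, gradF f θ (Zs i ω)‖ ≤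
        ∑ k, M k * (n : ℝ) ^ (-(α / (1 + α))) := by
      refine (norm_le_sum_abs _).trans (Finset.sum_le_sum fun k _ => ?_)
      have hk : ((n : ℝ)⁻¹ • ∑ i ∈ Finset.range n, gradF f θ (Zs i ω)) k =
          (n : ℝ)⁻¹ * ∑ i ∈ Finset.range n, (gradF f θ (Zs i ω)) k := by
        simp
      rw [hk, abs_mul, abs_of_pos (inv_pos.2 hn0), ← hexp]
      have := mul_le_mul_of_nonneg_left (hnot k).le (inv_pos.2 hn0).le
      linarith
    rw [← Finset.sum_mul] at hle
    linarith
  refine (measure_mono hsub).trans ((measure_biUnion_finset_le _ _).trans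
    ((Finset.sum_le_sum fun k _ => hM k n hn).trans ?_))
  rw [Finset.sum_const, Finset.card_univ, Fintype.card_fin, nsmul_eq_mul,
    ← ENNReal.ofReal_natCast, ← ENNReal.ofReal_mul (Nat.cast_nonneg d)]
  apply ENNReal.ofReal_le_ofReal
  rw [mul_div_assoc', div_le_iff₀ (by positivity)]
  nlinarith

/-! ### The empirical risk is a good approximation with high probability -/

/-- Once the average of `Λ₂` is within `1` of its mean, the empirical risk, like the risk, is
`A`-Lipschitz on the large ball. A finite net of mesh `η / (3 * A)` then suffices, `η` being split
into two Lipschitz errors and one deviation at a net point. -/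
theorem tendsto_measure_not_goodApprox {Λ₁ Λ₂ : 𝓩 → ℝ} {R A₁ A η : ℝ}
    (hf : ∀ θ, Measurable (f θ)) (hd : ∀ z, ContDiff ℝ 2 fun θ => f θ z)
    (hZs : ∀ i, Measurable (Zs i)) (hindep : iIndepFun Zs P)
    (hident : ∀ i, IdentDistrib (Zs i) Z P P) (hint : ∀ θ, Integrable (fun ω => f θ (Z ω)) P)
    (h₁ : IsEnvelope P f Z θ R Λ₁) (h₂ : IsEnvelope P f Z θ (R + A₁ + 1) Λ₂)
    (hA₁ : (∫ ω, Λ₁ (Z ω) ∂P) + 1 ≤ A₁) (hA : (∫ ω, Λ₂ (Z ω) ∂P) + 1 ≤ A) (hη : 0 < η) :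
    Tendsto (fun n : ℕ => P {ω | ¬GoodApprox (risk P f Z) (empRisk f (fun i => Zs i ω) n)
      θ R A₁ A η}) atTop (𝓝 0) := by
  have hA0 : 0 < A := by
    have : 0 ≤ ∫ ω, Λ₂ (Z ω) ∂P := integral_nonneg fun ω => h₂.nonneg _
    linarith
  obtain ⟨net, hnetsub, hnetfin, hnet⟩ := (isCompact_closedBall θ (R + A₁ + 1)).finite_cover_balls
    (show 0 < η / (3 * A) by positivity)
  have hae := (h₁.ae_forall_envelopedBy hident).and (h₂.ae_forall_envelopedBy hident)
  let dev : (𝓩 → ℝ) → ℝ → ℕ → Set Ω := fun h ε n => {ω | ε ≤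
    |(n : ℝ)⁻¹ * ∑ i ∈ Finset.range n, h (Zs i ω) - ∫ ω', h (Z ω') ∂P|}
  have hsub : ∀ n : ℕ, {ω | ¬GoodApprox (risk P f Z) (empRisk f (fun i => Zs i ω) n) θ R A₁ A η} ⊆
      ({ω | ¬((∀ i, EnvelopedBy (fun θ' => f θ' (Zs i ω)) θ R (Λ₁ (Zs i ω))) ∧
        ∀ i, EnvelopedBy (fun θ' => f θ' (Zs i ω)) θ (R + A₁ + 1) (Λ₂ (Zs i ω)))} ∪
        dev Λ₁ 1 n) ∪ (dev Λ₂ 1 n ∪ ⋃ p ∈ hnetfin.toFinset, dev (f p) (η / 3) n) := by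
    intro n ω hω
    by_contra hnot
    simp only [Set.mem_union, Set.mem_iUnion, Set.mem_ofPred_eq, not_or, not_exists, not_le,
      not_not, Set.Finite.mem_toFinset, dev] at hnot
    obtain ⟨⟨⟨he₁, he₂⟩, hd₁⟩, hd₂, hdp⟩ := hnot
    refine hω ?_
    have env₂ : EnvelopedBy (empRisk f (fun i => Zs i ω) n) θ (R + A₁ + 1) A :=
      (envelopedBy_empRisk hd he₂ n).mono (by linarith [(abs_lt.1 hd₂).2])
    refine ⟨contDiff_empRisk hd _ n, (envelopedBy_empRisk hd he₁ n).mono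
      (by linarith [(abs_lt.1 hd₁).2]), env₂, fun x hx => ?_⟩
    obtain ⟨p, hp, hxp⟩ := Set.mem_iUnion₂.1 (hnet hx)
    rw [mem_ball_iff_norm, lt_div_iff₀ (by positivity)] at hxp
    have b1 := abs_le.1 (env₂.abs_sub_le (contDiff_empRisk hd _ n) hx (hnetsub hp))
    have b2 := abs_le.1 (h₂.abs_risk_sub_le hd hint hx (hnetsub hp))
    have b3 := abs_lt.1 (hdp p hp)
    have b4 : (∫ ω, Λ₂ (Z ω) ∂P) * ‖x - p‖ ≤ A * ‖x - p‖ :=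
      mul_le_mul_of_nonneg_right (by linarith) (norm_nonneg _)
    simp only [empRisk, risk] at *
    rw [abs_le]
    constructor <;> linarith [b1.1, b1.2, b2.1, b2.2, b3.1, b3.2]
  have hlim : Tendsto (fun n => (0 + P (dev Λ₁ 1 n)) +
      (P (dev Λ₂ 1 n) + ∑ p ∈ hnetfin.toFinset, P (dev (f p) (η / 3) n))) atTop (𝓝 0) := by
    have t₁ := tendsto_measure_average_sub_ge hZs hindep hident h₁.measurable h₁.integrable one_pos
    have t₂ := tendsto_measure_average_sub_ge hZs hindep hident h₂.measurable h₂.integrable one_pos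
    have t₃ := tendsto_finsetSum hnetfin.toFinset fun p _ =>
      tendsto_measure_average_sub_ge hZs hindep hident (hf p) (hint p)
        (show 0 < η / 3 by positivity)
    simpa using ((tendsto_const_nhds (x := (0 : ENNReal))).add t₁).add (t₂.add t₃)
  refine tendsto_of_tendsto_of_tendsto_of_le_of_le tendsto_const_nhds hlim (fun _ => zero_le)
    fun n => ?_
  refine (measure_mono (hsub n)).trans ((measure_union_le _ _).trans (add_le_add
    ((measure_union_le _ _).trans (add_le_add (le_of_eq (ae_iff.1 hae)) le_rfl))
    ((measure_union_le _ _).trans (add_le_add le_rfl (measure_biUnion_finset_le _ _)))))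

/-- Outside of events of vanishing probability, the error of the multi-stage estimator is bounded
in terms of the last tolerance and of the gradient of the last empirical objective at the
minimiser. -/
theorem exists_norm_estimator_sub_le {α : ℝ} (hα : 0 < α)
    (hsm : SmoothMoment P f Z θ α) (hf : ∀ θ, Measurable (f θ)) (hZ : Measurable Z)
    (hZs : ∀ i, Measurable (Zs i)) (hindep : iIndepFun Zs P)
    (hident : ∀ i, IdentDistrib (Zs i) Z P P) (hint : ∀ θ, Integrable (fun ω => f θ (Z ω)) P)
    (hmin : ∀ x, risk P f Z θ ≤ risk P f Z x) (hconv : LocallyStronglyConvex (risk P f Z))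
    {Ceval Cgrad J : ℕ} (hCeval : 0 < Ceval) {α' δ κ τ β : ℝ} (hα' : α' ∈ Set.Ioc (0 : ℝ) 1)
    (hδ : δ ∈ Set.Ioo (0 : ℝ) 1) (hκ : 0 < κ) (hτ : 0 < τ) (hβ : β ∈ Set.Ioo (0 : ℝ) 1)
    (hJ : 1 ≤ J) (θ₀ : Vec d) :
    ∃ c > 0, ∃ bad : ℕ → Set Ω, Tendsto (fun B => P (bad B)) atTop (𝓝 0) ∧
      ∀ᶠ B : ℕ in atTop, ∀ ω ∉ bad B,
        c * ‖estimator Ceval Cgrad f (fun i => Zs i ω) θ₀ B α' δ J κ τ β - θ‖ ≤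
          stageTol α' τ δ B J +
            ‖gradient (empRisk f (fun i => Zs i ω) (stageSize κ δ B J)) θ‖ := by
  -- The constants are chosen without circularity: `R`, then `A₁`, which fixes the larger ball, then
  -- `A` and `c` on it, then `t`, `η` and `k₀`. The margin `1` absorbs the total rise `2 * J * η` of
  -- `F`.
  obtain ⟨R, hR, hlevel⟩ := hconv.exists_sublevel_subset hmin (risk P f Z θ₀ + 1)
  obtain ⟨Λ₁, hΛ₁⟩ := hsm.exists_isEnvelope hZ hf hα hR
  set A₁ := (∫ ω, Λ₁ (Z ω) ∂P) + 1 with hA₁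
  have hA₁0 : 0 ≤ A₁ := by
    have : 0 ≤ ∫ ω, Λ₁ (Z ω) ∂P := integral_nonneg fun ω => hΛ₁.nonneg _
    linarith
  obtain ⟨Λ₂, hΛ₂⟩ := hsm.exists_isEnvelope hZ hf hα (show 0 ≤ R + A₁ + 1 by linarith)
  set A := (∫ ω, Λ₂ (Z ω) ∂P) + 1 with hA
  have hA0 : 0 < A := by
    have : 0 ≤ ∫ ω, Λ₂ (Z ω) ∂P := integral_nonneg fun ω => hΛ₂.nonneg _
    linarith
  obtain ⟨c, hc, hcconv⟩ := hconv _ (isCompact_closedBall θ (R + A₁ + 1))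
  set t : ℝ := min 1 (c / (4 * A)) with ht
  have ht0 : 0 < t := lt_min one_pos (by positivity)
  have hJ0 : (0 : ℝ) < J := by exact_mod_cast hJ
  set η : ℝ := min (c * t ^ 2 / 16) (1 / (2 * J)) with hη
  have hη0 : 0 < η := lt_min (by positivity) (by positivity)
  obtain ⟨k₀, hk₀⟩ := exists_pow_lt_of_lt_one (show 0 < (A + c)⁻¹ by positivity) hβ.2
  have hk : β ^ k₀ * (A + c) ≤ 1 := by
    rw [← le_div_iff₀ (by positivity), one_div]
    exact hk₀.le
  have hβk : 0 < β ^ k₀ := pow_pos hβ.1 k₀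
  have hC : Constants (risk P f Z) θ R A₁ A c η t β k₀ :=
    { R_nonneg := hR
      A₁_nonneg := hA₁0
      c_pos := hc
      convex := hcconv
      t_pos := ht0
      t_le_one := min_le_left _ _
      A_mul_t_le := by
        calc A * t ≤ A * (c / (4 * A)) := by
              gcongr
              exact min_le_right _ _
          _ = c / 4 := by field_simp
      η_nonneg := hη0.le
      η_le := by linarith [min_le_left (c * t ^ 2 / 16) (1 / (2 * (J : ℝ)))]
      β_mem := hβ
      pow_mul_A := by nlinarith
      pow_mul_c := by nlinarith }
  have hlevel' : ∀ x, risk P f Z x ≤ risk P f Z θ₀ + 2 * J * η → x ∈ Metric.closedBall θ R := by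
    intro x hx
    refine hlevel x (hx.trans ?_)
    have : 2 * (J : ℝ) * η ≤ 2 * J * (1 / (2 * J)) := by
      gcongr
      exact min_le_right _ _
    rw [mul_one_div_cancel (by positivity)] at this
    linarith
  have hbad := tendsto_measure_not_goodApprox hf hsm.contDiff hZs hindep hident hint hΛ₁ hΛ₂
    hA₁.ge hA.ge hη0
  refine ⟨c / 2, half_pos hc, fun B => ⋃ j ∈ Finset.Icc 1 J,
    {ω | ¬GoodApprox (risk P f Z) (empRisk f (fun i => Zs i ω) (stageSize κ δ B j)) θ R A₁ A η},
    ?_, ?_⟩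
  · have hlim := tendsto_finsetSum (Finset.Icc 1 J) fun j hj =>
      hbad.comp (tendsto_stageSize hκ hδ (Finset.mem_Icc.1 hj).1)
    rw [Finset.sum_const_zero] at hlim
    exact tendsto_of_tendsto_of_tendsto_of_le_of_le tendsto_const_nhds hlim (fun _ => zero_le)
      fun B => measure_biUnion_finset_le _ _
  · filter_upwards [eventually_norm_estimator_sub_le (f := f) (Cgrad := Cgrad) hC hCeval hα' hδ
      hκ hτ hJ hlevel'] with B hB ω hω
    refine hB _ fun j hj => ?_
    by_contra hgood
    exact hω (Set.mem_biUnion hj hgood)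

end NoisyOpt

/-! ### Consistency and rate of the estimator -/

namespace NoisyOpt

theorem SmoothMoment.tendsto_measure_gradient_empRisk_ge {d : ℕ} {Ω 𝓩 : Type*}
    [MeasurableSpace Ω] {P : Measure Ω} [IsProbabilityMeasure P] [MeasurableSpace 𝓩]
    {f : Vec d → 𝓩 → ℝ} {Z : Ω → 𝓩} {Zs : ℕ → Ω → 𝓩} {θ : Vec d} {α : ℝ}
    (hα : α ∈ Set.Ioc (0 : ℝ) 1)
    (h : SmoothMoment P f Z θ α) (hf : ∀ θ, Measurable (f θ)) (hZ : Measurable Z)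
    (hZs : ∀ i, Measurable (Zs i)) (hindep : iIndepFun Zs P)
    (hident : ∀ i, IdentDistrib (Zs i) Z P P) (hint : ∀ θ, Integrable (fun ω => f θ (Z ω)) P)
    (hmin : ∀ x, risk P f Z θ ≤ risk P f Z x) {s : ℝ} (hs : 0 < s) :
    Tendsto (fun n : ℕ => P {ω | s ≤ ‖gradient (empRisk f (fun i => Zs i ω) n) θ‖})
      atTop (𝓝 0) := by
  rw [ENNReal.tendsto_nhds_zero]
  intro ε hε
  obtain ⟨ε', hε'0, hε'⟩ : ∃ ε' : ℝ, 0 < ε' ∧ ENNReal.ofReal ε' ≤ ε := by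
    obtain ⟨x, hx0, hx⟩ := ENNReal.lt_iff_exists_nnreal_btwn.1 hε
    exact ⟨x, by exact_mod_cast hx0, by simpa using hx.le⟩
  obtain ⟨M, hM, hrate⟩ := h.exists_measure_gradient_empRisk_ge_le hα hf hZ hZs hindep hident
    hint hmin hε'0
  have hlim : Tendsto (fun n : ℕ => M * (n : ℝ) ^ (-(α / (1 + α)))) atTop (𝓝 (M * 0)) :=
    ((tendsto_rpow_neg_atTop (div_pos hα.1 (by linarith [hα.1]))).comp
      tendsto_natCast_atTop_atTop).const_mul M
  rw [mul_zero] at hlim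
  filter_upwards [hlim.eventually (gt_mem_nhds hs), eventually_ge_atTop 1] with n hn hn1
  exact (measure_mono fun ω hω => hn.le.trans hω).trans ((hrate n hn1).trans hε')

end NoisyOpt

theorem theorem2 {d : ℕ}
    {Ω : Type*} [MeasurableSpace Ω] (P : Measure Ω) [IsProbabilityMeasure P]
    {𝓩 : Type*} [TopologicalSpace 𝓩] [PolishSpace 𝓩] [MeasurableSpace 𝓩] [BorelSpace 𝓩]
    (f : NoisyOpt.Vec d → 𝓩 → ℝ) (hf : Measurable (Function.uncurry f))
    -- `Z`, and the i.i.d. copies `Zs 0, Zs 1, …` of `Z`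
    (Z : Ω → 𝓩) (hZ : Measurable Z)
    (Zs : ℕ → Ω → 𝓩) (hZs : ∀ i, Measurable (Zs i))
    (hindep : iIndepFun Zs P) (hident : ∀ i, IdentDistrib (Zs i) Z P P)
    -- `F(θ) = 𝔼[f(θ, Z)]` is well defined, and `θstar` minimises it
    (hint : ∀ θ, Integrable (fun ω => f θ (Z ω)) P)
    (θstar : NoisyOpt.Vec d)
    (hmin : ∀ θ, NoisyOpt.risk P f Z θstar ≤ NoisyOpt.risk P f Z θ)
    -- the costs of one evaluation of `f` and of `∇f`
    (Ceval Cgrad : ℕ) (hCeval : 0 < Ceval) (hCgrad : 0 < Cgrad)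
    (hA1 : NoisyOpt.LocallyStronglyConvex (NoisyOpt.risk P f Z))
    (hA2 : ∃ α ∈ Set.Ioc (0 : ℝ) 1, NoisyOpt.SmoothMoment P f Z θstar α)
    (α' : ℝ) (hα' : α' ∈ Set.Ioc (0 : ℝ) 1)
    (θ₀ : NoisyOpt.Vec d) (J : ℕ) (hJ : 1 ≤ J)
    (κ τ : ℝ) (hκ : 0 < κ) (hτ : 0 < τ)
    (β : ℝ) (hβ : β ∈ Set.Ioo (0 : ℝ) 1)
    (δ : ℝ) (hδ : δ ∈ Set.Ioo (2 * α' / (1 + 3 * α')) 1) :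
    TendstoInMeasure P
      (fun (B : ℕ) ω =>
        ‖NoisyOpt.estimator Ceval Cgrad f (fun i => Zs i ω) θ₀ B α' δ J κ τ β - θstar‖)
      atTop (fun _ => (0 : ℝ)) ∧
    (NoisyOpt.SmoothMoment P f Z θstar α' →
      NoisyOpt.IsBigOP P
        (fun (B : ℕ) ω =>
          ‖NoisyOpt.estimator Ceval Cgrad f (fun i => Zs i ω) θ₀ B α' δ J κ τ β - θstar‖)
        (fun B => (B : ℝ) ^ (-(α' / (1 + α') * (1 - δ ^ J))))) := by
  have hδ0 : δ ∈ Set.Ioo (0 : ℝ) 1 := by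
    have := hα'.1
    exact ⟨lt_of_le_of_lt (by positivity) hδ.1, hδ.2⟩
  have hfm : ∀ θ, Measurable (f θ) := fun θ => hf.of_uncurry_left
  obtain ⟨α, hα, hsm⟩ := hA2
  obtain ⟨c, hc, bad, hbad, hbound⟩ := NoisyOpt.exists_norm_estimator_sub_le (Cgrad := Cgrad)
    hα.1 hsm hfm hZ hZs hindep hident hint hmin hA1 hCeval hα' hδ0 hκ hτ hβ hJ θ₀
  have hsize := NoisyOpt.tendsto_stageSize hκ hδ0 hJ
  refine ⟨tendstoInMeasure_iff_norm.2 fun ε hε => ?_, fun hsm' => ?_⟩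
  -- Off the bad event an error of at least `ε` makes tolerance plus gradient at least `c * ε`; once
  -- the tolerance is below half of this, the gradient must supply the other half.
  · have hgrad := (hsm.tendsto_measure_gradient_empRisk_ge hα hfm hZ hZs hindep hident hint hmin
      (show 0 < c * ε / 2 by positivity)).comp hsize
    refine tendsto_of_tendsto_of_tendsto_of_le_of_le' tendsto_const_nhds
      (by simpa using hbad.add hgrad) (Eventually.of_forall fun _ => zero_le) ?_
    filter_upwards [hbound, (NoisyOpt.tendsto_stageTol (τ := τ) hα'.1 hδ0 hJ).eventually
      (gt_mem_nhds (show 0 < c * ε / 2 by positivity))] with B hB htol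
    refine (measure_mono fun ω hω => ?_).trans (measure_union_le _ _)
    by_cases hωbad : ω ∈ bad B
    · exact Or.inl hωbad
    · right
      have h1 := hB ω hωbad
      rw [Set.mem_ofPred_eq, sub_zero, norm_norm] at hω
      have h2 := mul_le_mul_of_nonneg_left hω hc.le
      rw [Set.mem_ofPred_eq]
      linarith
  · intro ε hε
    obtain ⟨M, hM, hrate⟩ := hsm'.exists_measure_gradient_empRisk_ge_le hα' hfm hZ hZs hindep
      hident hint hmin hε.1
    set a := α' / (1 + α') with ha
    have ha0 : 0 < a := div_pos hα'.1 (by linarith [hα'.1])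
    -- The tolerance contributes `τ`. The gradient contributes `M * κ ^ (-a)`, because the last
    -- sample size is at least `κ * B ^ (1 - δ ^ J)`.
    refine ⟨(τ + M * κ ^ (-a)) / c, ?_⟩
    have hlim : Tendsto (fun B => P (bad B) + ENNReal.ofReal ε) atTop
        (𝓝 (0 + ENNReal.ofReal ε)) := hbad.add tendsto_const_nhds
    rw [zero_add] at hlim
    rw [← hlim.limsup_eq]
    refine limsup_le_limsup ?_
    filter_upwards [hbound, eventually_ge_atTop 1, hsize.eventually_ge_atTop 1] with B hB hB1 hn
    refine (measure_mono fun ω hω => ?_).trans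
      ((measure_union_le (bad B) _).trans (add_le_add le_rfl (hrate _ hn)))
    by_cases hωbad : ω ∈ bad B
    · exact Or.inl hωbad
    · right
      have hB0 : (0 : ℝ) < B := by exact_mod_cast hB1
      set r : ℝ := (B : ℝ) ^ (-(a * (1 - δ ^ J))) with hr
      have hr0 : 0 < r := Real.rpow_pos_of_pos hB0 _
      have h1 : _ ≤ τ * r + _ := hB ω hωbad
      rw [Set.mem_ofPred_eq, abs_div, abs_of_pos hr0, abs_norm, div_le_div_iff₀ hc hr0] at hω
      have h2 : (NoisyOpt.stageSize κ δ B J : ℝ) ^ (-a) ≤ κ ^ (-a) * r := by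
        have hle : κ * (B : ℝ) ^ (1 - δ ^ J) ≤ NoisyOpt.stageSize κ δ B J := Nat.le_ceil _
        refine (Real.rpow_le_rpow_of_nonpos (by positivity) hle (by linarith)).trans (le_of_eq ?_)
        rw [Real.mul_rpow hκ.le (by positivity), ← Real.rpow_mul hB0.le, hr]
        congr 2
        ring
      have h3 := mul_le_mul_of_nonneg_left h2 hM.le
      rw [Set.mem_ofPred_eq]
      linarith
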